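/- Let $\mathbb S^3(\sqrt2)\subset\mathbb R^4$ and $\mathbb S^2(\tfrac1{\sqrt2})\subset\mathbb R^3$ be the round spheres centred at the origin with radii $\sqrt2$ and $\tfrac1{\sqrt2}$, and let $\psi:\mathbb S^3(\sqrt2)\to\mathbb S^2(\tfrac1{\sqrt2})$ be the Hopf map $$\psi(x^1,x^2,x^3,x^4)=\tfrac{1}{2\sqrt2}\big(2x^1x^3+2x^2x^4,\;2x^2x^3-2x^1x^4,\;(x^1)^2+(x^2)^2-(x^3)^2-(x^4)^2\big).$$ Let $\Delta=-\operatorname{div}\operatorname{grad}$ be the Laplacian on smooth functions on $\mathbb S^3(\sqrt2)$, and let $C(\psi^{-1}T\mathbb S^2(\tfrac1{\sqrt2}))$ be the space of smooth sections of the pull-back bundle with its pull-back connection $\nabla^\psi$. The Jacobi operator of $\psi$ is $$J^\psi(V)=-\operatorname{trace}(\nabla^\psi)^2V+\operatorname{trace}R(d\psi\,\cdot,V)d\psi\,\cdot,\qquad V\in C(\psi^{-1}T\mathbb S^2(\tfrac1{\sqrt2})),$$ where $R(X,Y)=[\nabla_X,\nabla_Y]-\nabla_{[X,Y]}$ is the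 curvature tensor of $\mathbb S^2(\tfrac1{\sqrt2})$. Then $\psi$ is a harmonic map (it is smooth and $\operatorname{trace}\nabla d\psi=0$). The first (smallest) positive eigenvalue of $\Delta$ on $\mathbb S^3(\sqrt2)$ is $\lambda_1=\tfrac32$, and $J^\psi$ is negative definite on the space $$\{d\psi(\operatorname{grad}f_1)\;:\;f_1\in C^\infty(\mathbb S^3(\sqrt2)),\ \Delta f_1=\lambda_1f_1\}\subset C(\psi^{-1}T\mathbb S^2(\tfrac1{\sqrt2})),$$ that is, $\displaystyle\int_{\mathbb S^3(\sqrt2)}\langle J^\psi(V),V\rangle\,v_g<0$ for every $V\neq0$ in this space. -/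

import Mathlib

open MeasureTheory
open scoped ContDiff

noncomputable section

/-- Euclidean space `ℝⁿ` with its Euclidean inner product. -/
abbrev RSpace (n : ℕ) : Type := EuclideanSpace ℝ (Fin n)

/-- The round sphere of radius `r` centred at the origin of `ℝⁿ` (it has dimension `n - 1`). -/
abbrev RoundSphere (n : ℕ) (r : ℝ) : Type := Metric.sphere (0 : RSpace n) r

section Calculus

variable {n : ℕ} {r : ℝ} {W : Type} [NormedAddCommGroup W] [NormedSpace ℝ W]

/-- The extension of a function on the sphere to `ℝⁿ ∖ {0}` that is constant on rays, that is
`f` composed with the retraction `x ↦ (r / ‖x‖) x` onto the sphere. -/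
def radialExtend (f : RoundSphere n r → W) (x : RSpace n) : W :=
  Function.extend Subtype.val f 0 ((r / ‖x‖) • x)

/-- Smoothness of a function on the sphere: its composition with the smooth retraction of
`ℝⁿ ∖ {0}` onto the sphere is smooth. -/
def SphereSmooth (f : RoundSphere n r → W) : Prop :=
  ContDiffOn ℝ ∞ (radialExtend f) {0}ᶜ

/-- The differential of a vector-valued function on the sphere at `x`; on tangent vectors `X` at
`x` it is the derivative of `f` in the direction `X` (and it is `0` on the normal line). -/
def sphereDeriv (f : RoundSphere n r → W) (x : RoundSphere n r) : RSpace n →L[ℝ] W :=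
  fderiv ℝ (radialExtend f) (x : RSpace n)

/-- The tangent space of the sphere at `x`: the orthogonal complement of the position vector. -/
def tangentAt (x : RoundSphere n r) : Submodule ℝ (RSpace n) :=
  (Submodule.span ℝ {(x : RSpace n)})ᗮ

/-- Orthogonal projection of `ℝⁿ` onto the tangent space at `x`. -/
def tangentProj (x : RoundSphere n r) : RSpace n →L[ℝ] RSpace n :=
  (tangentAt x).starProjection

/-- The tangent vector field `y ↦ P_y u` on the sphere; if `u` is tangent at `x` it is a smooth
vector field that extends `u`. -/
def extendField (r : ℝ) (u : RSpace n) : RoundSphere n r → RSpace n :=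
  fun y => tangentProj y u

/-- Trace over the tangent space at `x` (with respect to an orthonormal basis) of a bilinear
expression in tangent vectors. -/
def tangentTrace (x : RoundSphere n r) (B : RSpace n → RSpace n → W) : W :=
  ∑ i, B (stdOrthonormalBasis ℝ (tangentAt x) i : RSpace n)
    (stdOrthonormalBasis ℝ (tangentAt x) i : RSpace n)

/-- The Levi-Civita connection `∇_X Y` at `x`: the tangential part of the derivative of the
tangent vector field `Y` in the direction `X`. -/
def leviCivita (Y : RoundSphere n r → RSpace n) (x : RoundSphere n r) (X : RSpace n) : RSpace n :=
  tangentProj x (sphereDeriv Y x X)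

/-- The curvature `R(X, Y) Z = ∇_X ∇_Y Z - ∇_Y ∇_X Z - ∇_{[X, Y]} Z` at `x`, for tangent vectors
`X, Y, Z` at `x`, computed (as it may be, `R` being a tensor) on vector fields extending them. -/
def sphereCurvature (x : RoundSphere n r) (X Y Z : RSpace n) : RSpace n :=
  leviCivita (fun y => leviCivita (extendField r Z) y (extendField r Y y)) x X
    - leviCivita (fun y => leviCivita (extendField r Z) y (extendField r X y)) x Y
    - leviCivita (extendField r Z) x
        (sphereDeriv (extendField r Y) x X - sphereDeriv (extendField r X) x Y)

/-- The gradient of a function on the sphere: the tangential part of the gradient of an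
extension of the function. -/
def sphereGrad (f : RoundSphere n r → ℝ) (x : RoundSphere n r) : RSpace n :=
  tangentProj x (gradient (radialExtend f) (x : RSpace n))

/-- The Laplacian on functions with the geometers' sign, `Δ f = - div grad f`. -/
def sphereLaplacian (f : RoundSphere n r → ℝ) (x : RoundSphere n r) : ℝ :=
  - tangentTrace x (fun X Y => inner ℝ (leviCivita (sphereGrad f) x X) Y)

/-- `μ` is an eigenvalue of the Laplacian on functions of the sphere of radius `r` in `ℝⁿ`. -/
def IsSphereEigenvalue (n : ℕ) (r μ : ℝ) : Prop :=
  ∃ f : RoundSphere n r → ℝ, SphereSmooth f ∧ f ≠ 0 ∧ ∀ x, sphereLaplacian f x = μ * f x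

/-- Multiplication by `r ≥ 0` from the unit sphere to the sphere of radius `r`. -/
def scaleSphere (n : ℕ) {r : ℝ} (hr : 0 ≤ r) (u : RoundSphere n 1) : RoundSphere n r :=
  ⟨r • (u : RSpace n), by simp [norm_smul, abs_of_nonneg hr]⟩

/-- The Riemannian volume measure of the sphere of radius `r` in `ℝⁿ`: the surface measure of the
unit sphere, carried over by `u ↦ r u` and multiplied by `r ^ (n - 1)`. -/
def sphereVolume (n : ℕ) {r : ℝ} (hr : 0 ≤ r) : Measure (RoundSphere n r) :=
  ENNReal.ofReal (r ^ (n - 1)) •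
    Measure.map (scaleSphere n hr) (volume : Measure (RSpace n)).toSphere

end Calculus

section Maps

variable {m n : ℕ} {r s : ℝ}

/-- The differential of a map between spheres. -/
def mapDeriv (φ : RoundSphere m r → RoundSphere n s) (x : RoundSphere m r) :
    RSpace m →L[ℝ] RSpace n :=
  sphereDeriv (fun y => (φ y : RSpace n)) x

/-- Smooth sections of the pull-back bundle `φ⁻¹ T S` (smooth vector fields along `φ`). -/
def pullbackSections (φ : RoundSphere m r → RoundSphere n s) :
    Set (RoundSphere m r → RSpace n) :=
  {V | SphereSmooth V ∧ ∀ x, V x ∈ tangentAt (φ x)}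

/-- The pull-back connection `∇^φ_X V` at `x` on sections of `φ⁻¹ T S`: the part of the derivative
of `V` in the direction `X` that is tangent to the target sphere at `φ x`. -/
def pullbackConn (φ : RoundSphere m r → RoundSphere n s) (V : RoundSphere m r → RSpace n)
    (x : RoundSphere m r) (X : RSpace m) : RSpace n :=
  tangentProj (φ x) (sphereDeriv V x X)

/-- The second fundamental form `(∇dφ)(X, Y) = ∇^φ_X (dφ(Y)) - dφ(∇_X Y)` of a map. -/
def secondFundForm (φ : RoundSphere m r → RoundSphere n s) (x : RoundSphere m r)
    (X Y : RSpace m) : RSpace n :=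
  pullbackConn φ (fun y => mapDeriv φ y (extendField r Y y)) x X
    - mapDeriv φ x (leviCivita (extendField r Y) x X)

/-- The tension field `τ(φ) = trace ∇dφ`. -/
def tensionField (φ : RoundSphere m r → RoundSphere n s) (x : RoundSphere m r) : RSpace n :=
  tangentTrace x (secondFundForm φ x)

/-- Harmonic maps: smooth maps whose tension field vanishes. -/
def IsHarmonicSphereMap (φ : RoundSphere m r → RoundSphere n s) : Prop :=
  SphereSmooth (fun x => (φ x : RSpace n)) ∧ ∀ x, tensionField φ x = 0

/-- The second covariant derivative `(∇²V)(X, Y) = ∇^φ_X ∇^φ_Y V - ∇^φ_{∇_X Y} V`. -/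
def secondCovDeriv (φ : RoundSphere m r → RoundSphere n s) (V : RoundSphere m r → RSpace n)
    (x : RoundSphere m r) (X Y : RSpace m) : RSpace n :=
  pullbackConn φ (fun y => pullbackConn φ V y (extendField r Y y)) x X
    - pullbackConn φ V x (leviCivita (extendField r Y) x X)

/-- The Laplacian `Δ^φ = - trace (∇^φ)²` on sections of `φ⁻¹ T S`. -/
def roughLaplacian (φ : RoundSphere m r → RoundSphere n s) (V : RoundSphere m r → RSpace n)
    (x : RoundSphere m r) : RSpace n :=
  - tangentTrace x (secondCovDeriv φ V x)

/-- The Jacobi operator `J^φ(V) = Δ^φ V + trace R(dφ ·, V) dφ ·`. -/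
def jacobiOperator (φ : RoundSphere m r → RoundSphere n s) (V : RoundSphere m r → RSpace n)
    (x : RoundSphere m r) : RSpace n :=
  roughLaplacian φ V x
    + tangentTrace x
        (fun X Y => sphereCurvature (φ x) (mapDeriv φ x X) (V x) (mapDeriv φ x Y))

/-- The Jacobi operator of `φ` is negative definite, for the `L²` inner product, on a set
(in practice a linear space) `S` of sections of `φ⁻¹ T S`. -/
def JacobiNegDefOn (hr : 0 ≤ r) (φ : RoundSphere m r → RoundSphere n s)
    (S : Set (RoundSphere m r → RSpace n)) : Prop :=
  ∀ V ∈ S, V ≠ 0 → ∫ x, inner ℝ (jacobiOperator φ V x) (V x) ∂(sphereVolume m hr) < 0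

end Maps

/-- The Hopf map `ψ : S³(√2) → S²(1/√2)`,
`ψ(z, w) = (1 / (2√2)) (2 z w̄, |z|² - |w|²)` with `z = x⁰ + i x¹`, `w = x² + i x³`. -/
def hopfMap (x : RoundSphere 4 (√2)) : RoundSphere 3 (1 / √2) :=
  ⟨(1 / (2 * √2)) • !₂[2 * x.1 0 * x.1 2 + 2 * x.1 1 * x.1 3,
      2 * x.1 1 * x.1 2 - 2 * x.1 0 * x.1 3,
      x.1 0 ^ 2 + x.1 1 ^ 2 - x.1 2 ^ 2 - x.1 3 ^ 2], by
    have h : ‖x.1‖ = √2 := mem_sphere_zero_iff_norm.1 x.2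
    have h2 : x.1 0 ^ 2 + x.1 1 ^ 2 + x.1 2 ^ 2 + x.1 3 ^ 2 = 2 := by
      have h3 : ‖x.1‖ ^ 2 = 2 := by rw [h]; norm_num
      rw [EuclideanSpace.real_norm_sq_eq, Fin.sum_univ_four] at h3
      exact h3
    have h4 : ‖(!₂[2 * x.1 0 * x.1 2 + 2 * x.1 1 * x.1 3,
        2 * x.1 1 * x.1 2 - 2 * x.1 0 * x.1 3,
        x.1 0 ^ 2 + x.1 1 ^ 2 - x.1 2 ^ 2 - x.1 3 ^ 2] : RSpace 3)‖ = 2 := by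
      rw [EuclideanSpace.norm_eq, Real.sqrt_eq_iff_mul_self_eq (by positivity) (by norm_num)]
      simp only [Fin.sum_univ_three, Real.norm_eq_abs, sq_abs]
      simp
      linear_combination (x.1 0 ^ 2 + x.1 1 ^ 2 + x.1 2 ^ 2 + x.1 3 ^ 2 + 2) * h2
    have h5 : (0 : ℝ) < √2 := by positivity
    rw [mem_sphere_zero_iff_norm, norm_smul, h4, Real.norm_eq_abs, abs_of_pos (by positivity)]
    field_simp⟩

/-- The space `{dψ(grad f) | Δ f = μ f}`, `f` ranging over the smooth real functions on
`S³(√2)`, for the Hopf map `ψ`. -/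
def hopfGradSections (μ : ℝ) : Set (RoundSphere 4 (√2) → RSpace 3) :=
  {V | ∃ f : RoundSphere 4 (√2) → ℝ, SphereSmooth f ∧ (∀ x, sphereLaplacian f x = μ * f x) ∧
    V = fun x => mapDeriv hopfMap x (sphereGrad f x)}

end

/-! ### Differential calculus on round spheres through ambient extensions. -/

section SphereCalculus

variable {n : ℕ} {r : ℝ} {W : Type} [NormedAddCommGroup W]


/-! Two facts carry the theorem: the eigenfunctions for the first positive eigenvalue are exactly
the linear functions `⟨a, ·⟩`, and each `V = dψ(grad ⟨a, ·⟩)` satisfies `J V = -V / 2`. The integral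
is then `-1/2` times the squared `L²` norm of `V`.

Spectrum. Up to a constant, the Laplacian is the sum of squares of the infinitesimal rotations
(`sphereLaplacian_eq_sum_rotDeriv`). Rotations preserve the volume, so the Laplacian is symmetric
(`integral_mul_sphereLaplacian_sub`). It maps `⟨u, x⟩ ^ (k + 2)` to a multiple of itself plus a
multiple of `⟨u, x⟩ ^ k`. For an eigenfunction with positive eigenvalue at most `(n - 1) / r²`,
symmetry therefore kills its integrals against all powers of linear forms, by induction on the
degree; only degree one at the extreme eigenvalue escapes. Stone–Weierstrass then forces the
function to vanish (`eq_zero_of_sphereLaplacian_eq`).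

Hopf map. It is `x ↦ B(x, x)` for a symmetric bilinear `B` (`hopfBilin`) with zero trace, which
gives harmonicity. In terms of `B` the section is `V(x) = 2 B(x, a) - ⟨a, x⟩ B(x, x)`. The rough
Laplacian multiplies it by `3/2` (`roughLaplacian_hopfSection`), and the curvature term multiplies
it by `-2` (`trace_sphereCurvature_hopfSection`). -/

theorem RoundSphere.norm_eq (x : RoundSphere n r) : ‖(x : RSpace n)‖ = r :=
  mem_sphere_zero_iff_norm.1 x.2

theorem RoundSphere.inner_self (x : RoundSphere n r) :
    inner ℝ (x : RSpace n) (x : RSpace n) = r ^ 2 := by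
  rw [real_inner_self_eq_norm_sq, x.norm_eq]

theorem RoundSphere.coe_ne_zero (hr : 0 < r) (x : RoundSphere n r) : (x : RSpace n) ≠ 0 := by
  rw [← norm_ne_zero_iff, x.norm_eq]; exact hr.ne'

theorem radialExtend_apply_of_ne (hr : 0 < r) (g : RoundSphere n r → W) {G : RSpace n → W}
    (h : ∀ y : RoundSphere n r, g y = G y) {y : RSpace n} (hy : y ≠ 0) :
    radialExtend g y = G ((r / ‖y‖) • y) := by
  have hm : (r / ‖y‖) • y ∈ Metric.sphere (0 : RSpace n) r := by
    rw [mem_sphere_zero_iff_norm, norm_smul, Real.norm_eq_abs, abs_of_pos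
      (div_pos hr (norm_pos_iff.2 hy)), div_mul_cancel₀ _ (norm_ne_zero_iff.2 hy)]
  have := Subtype.val_injective.extend_apply g 0 (⟨_, hm⟩ : RoundSphere n r)
  rw [radialExtend, this, h]

theorem radialExtend_coe (hr : 0 < r) (g : RoundSphere n r → W) (x : RoundSphere n r) :
    radialExtend g x = g x := by
  rw [radialExtend, x.norm_eq, div_self hr.ne', one_smul]
  exact Subtype.val_injective.extend_apply g 0 x

variable [NormedSpace ℝ W]

theorem mem_tangentAt (x : RoundSphere n r) (v : RSpace n) :
    v ∈ tangentAt x ↔ inner ℝ (x : RSpace n) v = 0 := by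
  rw [tangentAt, Submodule.mem_orthogonal_singleton_iff_inner_right]

theorem tangentProj_apply (x : RoundSphere n r) (v : RSpace n) :
    tangentProj x v = v - (inner ℝ (x : RSpace n) v / r ^ 2) • (x : RSpace n) := by
  have h : tangentProj x = (Submodule.span ℝ {(x : RSpace n)})ᗮ.starProjection := rfl
  rw [h, Submodule.starProjection_orthogonal']
  simp [Submodule.starProjection_singleton, x.norm_eq]

theorem tangentProj_eq_self {x : RoundSphere n r} {v : RSpace n}
    (h : inner ℝ (x : RSpace n) v = 0) : tangentProj x v = v := by
  simp [tangentProj_apply, h]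

theorem inner_tangentProj (hr : 0 < r) (x : RoundSphere n r) (v : RSpace n) :
    inner ℝ (x : RSpace n) (tangentProj x v) = 0 := by
  rw [tangentProj_apply, inner_sub_right, inner_smul_right, x.inner_self]
  field_simp; ring

theorem tangentProj_smul_self (hr : 0 < r) (x : RoundSphere n r) (c : ℝ) :
    tangentProj x (c • (x : RSpace n)) = 0 := by
  rw [tangentProj_apply, inner_smul_right, x.inner_self, mul_div_cancel_right₀ _ (by positivity),
    sub_self]

/-- The standard basis vectors of `ℝⁿ`. -/
noncomputable abbrev stdVec {n : ℕ} (j : Fin n) : RSpace n := EuclideanSpace.single j 1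

theorem sum_smul_stdVec (v : RSpace n) : ∑ j, v j • stdVec j = v := by
  ext i; simp [Finset.sum_apply, Pi.single_apply]

/-- The trace over the tangent space of a bilinear map defined on all of `ℝⁿ`. -/
theorem tangentTrace_eq (x : RoundSphere n r) (B : RSpace n → RSpace n → W)
    (B' : RSpace n →ₗ[ℝ] RSpace n →ₗ[ℝ] W)
    (h : ∀ X Y, inner ℝ (x : RSpace n) X = 0 → inner ℝ (x : RSpace n) Y = 0 → B X Y = B' X Y) :
    tangentTrace x B
      = ∑ j, B' (stdVec j) (stdVec j) - (1 / r ^ 2) • B' (x : RSpace n) (x : RSpace n) := by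
  set b := stdOrthonormalBasis ℝ (tangentAt x) with hb
  have hexp : ∀ v : RSpace n, B' v v = ∑ j, ∑ k, (v j * v k) • B' (stdVec j) (stdVec k) := by
    intro v
    conv_lhs => rw [← sum_smul_stdVec v]
    simp [map_sum, LinearMap.sum_apply, Finset.smul_sum, smul_smul]
    rw [Finset.sum_comm]
    simp only [mul_comm]
  -- The sum of `bᵢ ⊗ bᵢ` over an orthonormal basis of the tangent space is the matrix of the
  -- projection, `id - x ⊗ x / r²`.
  have hcoef : ∀ j k : Fin n, ∑ i, ((b i : RSpace n) j * (b i : RSpace n) k)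
      = (if j = k then 1 else 0) - (1 / r ^ 2) * ((x : RSpace n) j * (x : RSpace n) k) := by
    intro j k
    have h1 : ∀ (i) (j : Fin n), (b i : RSpace n) j
        = inner ℝ (b i) ((tangentAt x).orthogonalProjectionOnto (stdVec j)) := by
      intro i j
      rw [Submodule.inner_orthogonalProjectionOnto_eq_of_mem_left]
      simp [stdVec, EuclideanSpace.inner_single_right]
    have h2 : ∑ i, ((b i : RSpace n) j * (b i : RSpace n) k)
        = inner ℝ ((tangentAt x).orthogonalProjectionOnto (stdVec j))
          ((tangentAt x).orthogonalProjectionOnto (stdVec k)) := by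
      rw [← b.sum_inner_mul_inner]
      refine Finset.sum_congr rfl fun i _ => ?_
      rw [h1 i j, h1 i k, real_inner_comm]
    rw [h2, Submodule.inner_orthogonalProjectionOnto_eq_of_mem_left]
    have h3 : ((tangentAt x).orthogonalProjectionOnto (stdVec j) : RSpace n)
        = tangentProj x (stdVec j) := rfl
    rw [h3, tangentProj_apply, inner_sub_left, inner_smul_left]
    simp [stdVec, EuclideanSpace.inner_single_right]
    simp only [eq_comm]
    ring
  have hmem : ∀ i, inner ℝ (x : RSpace n) (b i : RSpace n) = 0 := fun i =>
    (mem_tangentAt x _).1 (b i).2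
  calc tangentTrace x B = ∑ i, B' (b i : RSpace n) (b i : RSpace n) :=
        Finset.sum_congr rfl fun i _ => h _ _ (hmem i) (hmem i)
    _ = ∑ j, ∑ k, (∑ i, ((b i : RSpace n) j * (b i : RSpace n) k)) •
          B' (stdVec j) (stdVec k) := by
        simp_rw [hexp (b _ : RSpace n), Finset.sum_smul]
        rw [Finset.sum_comm]
        refine Finset.sum_congr rfl fun j _ => ?_
        rw [Finset.sum_comm]
    _ = _ := by
        simp_rw [hcoef, sub_smul, Finset.sum_sub_distrib]
        rw [hexp (x : RSpace n)]
        simp [Finset.smul_sum, smul_smul]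

theorem hasFDerivAt_retraction (hr : 0 < r) (x : RoundSphere n r) :
    HasFDerivAt (fun y : RSpace n => (r / ‖y‖) • y) (tangentProj x) (x : RSpace n) := by
  have h1 : HasFDerivAt (fun y : RSpace n => ‖y‖ ^ 2) (2 • innerSL ℝ (x : RSpace n))
      (x : RSpace n) := (hasStrictFDerivAt_norm_sq (x : RSpace n)).hasFDerivAt
  have hn : ‖(x : RSpace n)‖ ^ 2 = r ^ 2 := by rw [x.norm_eq]
  -- The factor `r / ‖y‖` is treated as a function of `s = ‖y‖²`, whose derivative in `y` is linear.
  have h2 : HasDerivAt (fun s : ℝ => r / √s) (-(1 / (2 * r ^ 2))) (‖(x : RSpace n)‖ ^ 2) := by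
    rw [hn]
    have h3 := (hasDerivAt_const (r ^ 2) r).div (Real.hasDerivAt_sqrt (x := r ^ 2) (by positivity))
      (by positivity)
    refine h3.congr_deriv ?_
    rw [Real.sqrt_sq hr.le]; field_simp; ring
  have h4 := (h2.comp_hasFDerivAt (x : RSpace n) h1).smul (hasFDerivAt_id (x : RSpace n))
  refine (h4.congr_of_eventuallyEq (Filter.Eventually.of_forall fun y => ?_)).congr_fderiv ?_
  · simp [Real.sqrt_sq (norm_nonneg y)]
  · ext1 v
    rw [tangentProj_apply]
    simp [x.norm_eq, Real.sqrt_sq hr.le, hr.ne']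
    rw [sub_eq_add_neg]
    congr 1
    rw [← neg_smul]
    field_simp
    exact neg_smul _ _

/-- Near `x` the radial extension is `G` composed with the retraction, whose derivative at `x` is
the tangential projection. Any convenient extension, usually a polynomial one, may thus replace the
radial one in computations. -/
theorem sphereDeriv_eq (hr : 0 < r) {g : RoundSphere n r → W} {G : RSpace n → W}
    (h : ∀ y : RoundSphere n r, g y = G y) {x : RoundSphere n r}
    (hG : DifferentiableAt ℝ G (x : RSpace n)) (X : RSpace n) :
    sphereDeriv g x X = fderiv ℝ G x (tangentProj x X) := by
  have hx : (r / ‖(x : RSpace n)‖) • (x : RSpace n) = x := by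
    rw [x.norm_eq, div_self hr.ne', one_smul]
  have h1 : HasFDerivAt G (fderiv ℝ G x) ((fun y : RSpace n => (r / ‖y‖) • y) (x : RSpace n)) := by
    simp only [hx]; exact hG.hasFDerivAt
  have h2 := HasFDerivAt.comp (f := fun y : RSpace n => (r / ‖y‖) • y) (x : RSpace n) h1
    (hasFDerivAt_retraction hr x)
  have h3 : radialExtend g =ᶠ[nhds (x : RSpace n)] G ∘ fun y : RSpace n => (r / ‖y‖) • y := by
    filter_upwards [isOpen_ne.mem_nhds (x.coe_ne_zero hr)] with y hy
    exact radialExtend_apply_of_ne hr g h hy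
  rw [sphereDeriv, (h2.congr_of_eventuallyEq h3).fderiv]
  rfl

theorem sphereSmooth_of_contDiffOn (hr : 0 < r) {g : RoundSphere n r → W} {G : RSpace n → W}
    (h : ∀ y : RoundSphere n r, g y = G y) (hG : ContDiffOn ℝ ∞ G {0}ᶜ) : SphereSmooth g := by
  have h1 : ContDiffOn ℝ ∞ (fun y : RSpace n => (r / ‖y‖) • y) {0}ᶜ := by
    intro y hy
    refine ContDiffAt.contDiffWithinAt ?_
    exact (contDiffAt_const.div (contDiffAt_norm ℝ hy) (norm_ne_zero_iff.2 hy)).smul contDiffAt_id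
  refine (hG.comp h1 fun y hy => ?_).congr fun y hy => radialExtend_apply_of_ne hr g h hy
  have hy' : y ≠ 0 := hy
  simp [hr.ne', hy']

theorem SphereSmooth.continuous (hr : 0 < r) {g : RoundSphere n r → W} (hg : SphereSmooth g) :
    Continuous g := by
  have h := hg.continuousOn.comp_continuous continuous_subtype_val
    (fun x : RoundSphere n r => x.coe_ne_zero hr)
  exact h.congr fun x => radialExtend_coe hr g x

/-- The polynomial extension to `ℝⁿ` of the tangential part of a vector field. -/
noncomputable def projExtend (r : ℝ) (y v : RSpace n) : RSpace n :=
  v - (inner ℝ y v / r ^ 2) • y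

theorem tangentProj_eq_projExtend (x : RoundSphere n r) (v : RSpace n) :
    tangentProj x v = projExtend r x v := tangentProj_apply x v

theorem hasFDerivAt_projExtend_const (r : ℝ) (y v : RSpace n) :
    HasFDerivAt (fun y => projExtend r y v)
      (-((inner ℝ y v / r ^ 2) • ContinuousLinearMap.id ℝ (RSpace n)
        + ((1 / r ^ 2) • innerSL ℝ v).smulRight y)) y := by
  have h1 : HasFDerivAt (fun y : RSpace n => inner ℝ y v / r ^ 2)
      ((1 / r ^ 2) • innerSL ℝ v) y := by
    have := ((innerSL ℝ v).hasFDerivAt (x := y)).const_smul (1 / r ^ 2)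
    refine this.congr_of_eventuallyEq (Filter.Eventually.of_forall fun z => ?_)
    simp [real_inner_comm, div_eq_inv_mul]
  exact ((hasFDerivAt_const v y).sub (h1.smul (hasFDerivAt_id y))).congr_fderiv (by simp)

theorem sphereDeriv_extendField (hr : 0 < r) (x : RoundSphere n r) {X : RSpace n}
    (hX : inner ℝ (x : RSpace n) X = 0) (Y : RSpace n) :
    sphereDeriv (extendField r Y) x X
      = -((inner ℝ (x : RSpace n) Y / r ^ 2) • X + (inner ℝ X Y / r ^ 2) • (x : RSpace n)) := by
  rw [sphereDeriv_eq (g := extendField r Y) (G := fun y => projExtend r y Y) hr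
    (fun y => tangentProj_eq_projExtend y Y)
    (hasFDerivAt_projExtend_const r _ Y).differentiableAt,
    (hasFDerivAt_projExtend_const r _ Y).fderiv, tangentProj_eq_self hX]
  simp [div_eq_inv_mul, real_inner_comm]

theorem leviCivita_extendField (hr : 0 < r) (x : RoundSphere n r) {X : RSpace n}
    (hX : inner ℝ (x : RSpace n) X = 0) (Y : RSpace n) :
    leviCivita (extendField r Y) x X = -((inner ℝ (x : RSpace n) Y / r ^ 2) • X) := by
  rw [leviCivita, sphereDeriv_extendField hr x hX, map_neg, map_add, tangentProj_smul_self hr,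
    map_smul, tangentProj_eq_self hX, add_zero]

/-- The projected constant fields are parallel at the base point, so the correction terms `∇_X Y` in
second covariant derivatives vanish there. -/
theorem leviCivita_extendField_eq_zero (hr : 0 < r) (x : RoundSphere n r) {X Y : RSpace n}
    (hX : inner ℝ (x : RSpace n) X = 0) (hY : inner ℝ (x : RSpace n) Y = 0) :
    leviCivita (extendField r Y) x X = 0 := by
  simp [leviCivita_extendField hr x hX, hY]

theorem leviCivita_leviCivita_extendField (hr : 0 < r) (x : RoundSphere n r) {X Y Z : RSpace n}
    (hX : inner ℝ (x : RSpace n) X = 0) (hY : inner ℝ (x : RSpace n) Y = 0)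
    (hZ : inner ℝ (x : RSpace n) Z = 0) :
    leviCivita (fun y => leviCivita (extendField r Z) y (extendField r Y y)) x X
      = -((inner ℝ X Z / r ^ 2) • Y) := by
  -- Away from `x` the vector `Z` is no longer tangent, so the inner derivative is needed at every
  -- `y`. Its scalar factor vanishes at `x`, and only the derivative of that factor survives.
  have h1 : ∀ y : RoundSphere n r, leviCivita (extendField r Z) y (extendField r Y y)
      = (fun y : RSpace n => (-(inner ℝ y Z / r ^ 2)) • projExtend r y Y) (y : RSpace n) := by
    intro y
    rw [extendField, leviCivita_extendField hr y (inner_tangentProj hr y Y),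
      tangentProj_eq_projExtend]
    simp
  have h2 : HasFDerivAt (fun y : RSpace n => -(inner ℝ y Z / r ^ 2))
      (-((1 / r ^ 2) • innerSL ℝ Z)) (x : RSpace n) := by
    have := (((innerSL ℝ Z).hasFDerivAt (x := (x : RSpace n))).const_smul (1 / r ^ 2)).neg
    refine this.congr_of_eventuallyEq (Filter.Eventually.of_forall fun z => ?_)
    simp [real_inner_comm, div_eq_inv_mul]
  have h3 := h2.smul (hasFDerivAt_projExtend_const r (x : RSpace n) Y)
  rw [leviCivita, sphereDeriv_eq hr h1 h3.differentiableAt]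
  erw [h3.fderiv]
  rw [tangentProj_eq_self hX]
  simp [hZ, ← tangentProj_eq_projExtend, tangentProj_eq_self hY, div_eq_inv_mul, real_inner_comm]

/-- The round sphere of radius `r` has constant sectional curvature `1 / r²`. -/
theorem sphereCurvature_eq (hr : 0 < r) (x : RoundSphere n r) {X Y Z : RSpace n}
    (hX : inner ℝ (x : RSpace n) X = 0) (hY : inner ℝ (x : RSpace n) Y = 0)
    (hZ : inner ℝ (x : RSpace n) Z = 0) :
    sphereCurvature x X Y Z = (1 / r ^ 2) • (inner ℝ Y Z • X - inner ℝ X Z • Y) := by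
  rw [sphereCurvature, leviCivita_leviCivita_extendField hr x hX hY hZ,
    leviCivita_leviCivita_extendField hr x hY hX hZ, sphereDeriv_extendField hr x hX,
    sphereDeriv_extendField hr x hY, hX, hY, real_inner_comm X Y]
  simp [leviCivita, smul_sub, smul_smul, div_eq_inv_mul]
  abel

/-- The Laplacian on the sphere in terms of an arbitrary extension to `ℝⁿ ∖ {0}`. -/
theorem sphereLaplacian_eq (hr : 0 < r) {f : RoundSphere n r → ℝ} {G : RSpace n → ℝ}
    (h : ∀ y : RoundSphere n r, f y = G y) (hG : ContDiffOn ℝ ∞ G {0}ᶜ) (x : RoundSphere n r) :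
    sphereLaplacian f x = -(∑ j, fderiv ℝ (fderiv ℝ G) x (stdVec j) (stdVec j)
      - (1 / r ^ 2) * fderiv ℝ (fderiv ℝ G) x x x - ((n - 1) / r ^ 2) * fderiv ℝ G x x) := by
  have hx := x.coe_ne_zero hr
  have hopen : ∀ y : RSpace n, y ≠ 0 → {0}ᶜ ∈ nhds y := fun y hy =>
    isOpen_compl_singleton.mem_nhds hy
  have hd : ∀ y : RSpace n, y ≠ 0 → DifferentiableAt ℝ G y := fun y hy =>
    (hG.contDiffAt (hopen y hy)).differentiableAt (by simp)
  have hdd : DifferentiableAt ℝ (fderiv ℝ G) (x : RSpace n) :=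
    ((hG.contDiffAt (hopen _ hx)).fderiv_right (m := 1) (by norm_cast)).differentiableAt (by simp)
  -- An ambient field that restricts to the gradient on the sphere: the gradient of `G` minus its
  -- radial part, with `‖y‖²` replaced by the constant `r²`.
  set K : RSpace n → RSpace n := fun y =>
    ∑ j, fderiv ℝ G y (stdVec j) • stdVec j - (fderiv ℝ G y y / r ^ 2) • y with hK
  have hgrad : ∀ y : RoundSphere n r, sphereGrad f y = K y := by
    intro y
    have hin : ∀ v, inner ℝ (gradient (radialExtend f) (y : RSpace n)) v
        = fderiv ℝ G y (tangentProj y v) := by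
      intro v
      rw [gradient, InnerProductSpace.toDual_symm_apply, ← sphereDeriv_eq hr h
        (hd _ (y.coe_ne_zero hr))]
      rfl
    rw [sphereGrad]
    refine ext_inner_right ℝ fun v => ?_
    have hsym : inner ℝ (tangentProj y (gradient (radialExtend f) (y : RSpace n))) v
        = inner ℝ (gradient (radialExtend f) (y : RSpace n)) (tangentProj y v) := by
      simp only [tangentProj_apply, inner_sub_left, inner_sub_right, real_inner_smul_left,
        real_inner_smul_right]
      rw [real_inner_comm (y : RSpace n) (gradient _ _)]
      ring
    rw [hsym, hin, tangentProj_eq_self (inner_tangentProj hr y v), tangentProj_apply, hK]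
    simp only [inner_sub_left, sum_inner, real_inner_smul_left, map_sub, map_smul]
    congr 1
    · conv_lhs => rw [← sum_smul_stdVec v]
      simp [EuclideanSpace.inner_single_left, map_sum, mul_comm]
    · simp only [smul_eq_mul]
      ring
  have hKd : DifferentiableAt ℝ K (x : RSpace n) := by
    rw [hK]; fun_prop
  -- The intrinsic Hessian is the ambient one minus the radial derivative of `G` times the metric
  -- over `r²`, which accounts for the bending of the sphere.
  have hKi : ∀ X Y : RSpace n, inner ℝ (x : RSpace n) X = 0 → inner ℝ (x : RSpace n) Y = 0 →
      inner ℝ (fderiv ℝ K x X) Y = fderiv ℝ (fderiv ℝ G) x X Y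
        - fderiv ℝ G x x / r ^ 2 * inner ℝ X Y := by
    intro X Y hX hY
    have h1 : HasFDerivAt (fun y => inner ℝ (K y) Y)
        ((innerSL ℝ Y).comp (fderiv ℝ K x)) (x : RSpace n) := by
      have := ((innerSL ℝ Y).hasFDerivAt (x := K x)).comp (x : RSpace n) hKd.hasFDerivAt
      refine this.congr_of_eventuallyEq (Filter.Eventually.of_forall fun z => ?_)
      simp [real_inner_comm]
    have h2 : (fun y => inner ℝ (K y) Y)
        = fun y => fderiv ℝ G y Y - (fderiv ℝ G y y / r ^ 2) * inner ℝ Y y := by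
      funext y
      rw [hK]
      simp only [inner_sub_left, sum_inner, real_inner_smul_left]
      congr 1
      · conv_rhs => rw [← sum_smul_stdVec Y]
        simp [EuclideanSpace.inner_single_left, map_sum, mul_comm]
      · rw [real_inner_comm]
    have h3 : HasFDerivAt (fun y => fderiv ℝ G y Y)
        ((fderiv ℝ (fderiv ℝ G) x).flip Y) (x : RSpace n) := by
      refine (hdd.hasFDerivAt.clm_apply (hasFDerivAt_const Y _)).congr_fderiv ?_
      ext; simp
    have h4 : DifferentiableAt ℝ (fun y => fderiv ℝ G y y / r ^ 2) (x : RSpace n) := by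
      fun_prop
    have h5 := h3.sub (h4.hasFDerivAt.mul ((innerSL ℝ Y).hasFDerivAt (x := (x : RSpace n))))
    rw [h2] at h1
    have h6 := congrArg (fun L => L X) (h1.unique h5)
    simp only [ContinuousLinearMap.comp_apply, innerSL_apply_apply] at h6
    rw [real_inner_comm, h6]
    have hY' : inner ℝ Y (x : RSpace n) = 0 := by rw [real_inner_comm, hY]
    simp [hY', real_inner_comm]
  have hB := tangentTrace_eq x (fun X Y => inner ℝ (leviCivita (sphereGrad f) x X) Y)
    (LinearMap.mk₂ ℝ (fun X Y => fderiv ℝ (fderiv ℝ G) x X Y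
        - fderiv ℝ G x x / r ^ 2 * inner ℝ X Y)
      (by intros; simp [inner_add_left]; ring)
      (by intros; simp [real_inner_smul_left]; ring)
      (by intros; simp [inner_add_right]; ring)
      (by intros; simp [real_inner_smul_right]; ring)) (by
    intro X Y hX hY
    rw [leviCivita, sphereDeriv_eq hr hgrad hKd, tangentProj_eq_self hX, LinearMap.mk₂_apply,
      ← hKi X Y hX hY, tangentProj_apply, inner_sub_left, real_inner_smul_left, hY]
    simp)
  rw [sphereLaplacian, hB]
  simp only [LinearMap.mk₂_apply, x.inner_self]
  simp [Finset.sum_sub_distrib]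
  field_simp
  ring

end SphereCalculus

/-! ### Rotation invariance of the volume and symmetry of the Laplacian. -/

section SphereMeasure

variable {n : ℕ} {r : ℝ}

instance (hr : 0 ≤ r) : IsFiniteMeasure (sphereVolume n hr) := by
  unfold sphereVolume
  exact Measure.smul_finite _ ENNReal.ofReal_ne_top

theorem continuous_scaleSphere (hr : 0 ≤ r) : Continuous (scaleSphere n hr) :=
  Continuous.subtype_mk (continuous_subtype_val.const_smul r) _

theorem surjective_scaleSphere (hr : 0 < r) : Function.Surjective (scaleSphere n hr.le) := by
  intro x
  refine ⟨⟨r⁻¹ • (x : RSpace n), ?_⟩, Subtype.ext ?_⟩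
  · rw [mem_sphere_zero_iff_norm, norm_smul, x.norm_eq, Real.norm_eq_abs,
      abs_of_pos (inv_pos.2 hr), inv_mul_cancel₀ hr.ne']
  · simp [scaleSphere, smul_smul, hr.ne']

theorem isOpenPosMeasure_sphereVolume (hr : 0 < r) :
    (sphereVolume n hr.le).IsOpenPosMeasure := by
  have h := (continuous_scaleSphere (n := n) hr.le).isOpenPosMeasure_map
    (μ := (volume : Measure (RSpace n)).toSphere) (surjective_scaleSphere hr)
  constructor
  intro U hU hne
  have h0 : ENNReal.ofReal (r ^ (n - 1)) ≠ 0 := by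
    simpa using pow_pos hr (n - 1)
  simp [sphereVolume, h0, hU.measure_ne_zero _ hne]

/-- The action of a linear isometry on a sphere. -/
noncomputable def sphereIsometry (e : RSpace n ≃ₗᵢ[ℝ] RSpace n) (x : RoundSphere n r) : RoundSphere n r :=
  ⟨e x, by simp⟩

theorem continuous_sphereIsometry (e : RSpace n ≃ₗᵢ[ℝ] RSpace n) :
    Continuous (sphereIsometry (r := r) e) :=
  Continuous.subtype_mk (e.continuous.comp continuous_subtype_val) _

open scoped Pointwise in
theorem map_sphereIsometry_toSphere (e : RSpace n ≃ₗᵢ[ℝ] RSpace n) :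
    Measure.map (sphereIsometry e) (volume : Measure (RSpace n)).toSphere
      = (volume : Measure (RSpace n)).toSphere := by
  ext s hs
  have hm := (continuous_sphereIsometry (r := 1) e).measurable
  rw [Measure.map_apply hm hs, Measure.toSphere_apply' _ (hm hs), Measure.toSphere_apply' _ hs]
  congr 1
  -- The surface measure of `s` is a multiple of the Lebesgue measure of the cone over `s`, and a
  -- linear isometry carries cones to cones.
  have h : Set.Ioo (0 : ℝ) 1 • (Subtype.val '' (sphereIsometry e ⁻¹' s))
      = e ⁻¹' (Set.Ioo (0 : ℝ) 1 • (Subtype.val '' s)) := by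
    ext v
    simp only [Set.mem_smul, Set.mem_preimage, Set.mem_image]
    constructor
    · rintro ⟨t, ht, _, ⟨x, hx, rfl⟩, rfl⟩
      exact ⟨t, ht, _, ⟨_, hx, rfl⟩, by simp [sphereIsometry]⟩
    · rintro ⟨t, ht, _, ⟨x, hx, rfl⟩, h⟩
      refine ⟨t, ht, _, ⟨sphereIsometry e.symm x, ?_, rfl⟩, ?_⟩
      · have : sphereIsometry e (sphereIsometry e.symm x) = x := Subtype.ext (by
          simp [sphereIsometry])
        rwa [this]
      · apply e.injective
        simp [sphereIsometry, ← h]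
  rw [h]
  exact e.measurePreserving.measure_preimage_equiv (f := e.toMeasurableEquiv) _

theorem measurePreserving_sphereIsometry (hr : 0 ≤ r) (e : RSpace n ≃ₗᵢ[ℝ] RSpace n) :
    MeasurePreserving (sphereIsometry e) (sphereVolume n hr) (sphereVolume n hr) := by
  have hm := (continuous_sphereIsometry (r := r) e).measurable
  have hm1 := (continuous_sphereIsometry (r := 1) e).measurable
  have hs := (continuous_scaleSphere (n := n) hr).measurable
  refine ⟨hm, ?_⟩
  rw [sphereVolume, Measure.map_smul, Measure.map_map hm hs]
  have : sphereIsometry e ∘ scaleSphere n hr = scaleSphere n hr ∘ sphereIsometry e := by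
    funext x; exact Subtype.ext (by simp [sphereIsometry, scaleSphere])
  rw [this, ← Measure.map_map hs hm1, map_sphereIsometry_toSphere]

theorem integral_comp_sphereIsometry (hr : 0 ≤ r) (e : RSpace n ≃ₗᵢ[ℝ] RSpace n)
    {g : RoundSphere n r → ℝ} (hg : Continuous g) :
    ∫ x, g (sphereIsometry e x) ∂(sphereVolume n hr) = ∫ x, g x ∂(sphereVolume n hr) := by
  have h := measurePreserving_sphereIsometry hr e
  conv_rhs => rw [← h.map_eq]
  rw [integral_map h.aemeasurable hg.aestronglyMeasurable]

/-- The derivative of `h` along the linear vector field `A`. -/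
noncomputable def rotDeriv (A : RSpace n →L[ℝ] RSpace n) (h : RSpace n → ℝ) (x : RSpace n) : ℝ :=
  fderiv ℝ h x (A x)

theorem contDiffOn_rotDeriv (A : RSpace n →L[ℝ] RSpace n) {h : RSpace n → ℝ}
    (hh : ContDiffOn ℝ ∞ h {0}ᶜ) : ContDiffOn ℝ ∞ (rotDeriv A h) {0}ᶜ :=
  (hh.fderiv_of_isOpen isOpen_compl_singleton (by simp)).clm_apply A.contDiff.contDiffOn

theorem continuous_restrict_of_contDiffOn (hr : 0 < r) {h : RSpace n → ℝ}
    (hh : ContDiffOn ℝ ∞ h {0}ᶜ) : Continuous (fun x : RoundSphere n r => h x) :=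
  hh.continuousOn.comp_continuous continuous_subtype_val fun x => x.coe_ne_zero hr

theorem Continuous.integrable_sphereVolume (hr : 0 ≤ r) {W : Type} [NormedAddCommGroup W]
    {g : RoundSphere n r → W} (hg : Continuous g) : Integrable g (sphereVolume n hr) :=
  hg.integrable_of_hasCompactSupport (HasCompactSupport.of_compactSpace g)

/-- The flow is `exp (t A)`, which is unitary because `A` is skew-adjoint. -/
theorem exists_rotation_flow (A : RSpace n →L[ℝ] RSpace n)
    (hA : ∀ x y, inner ℝ (A x) y = - inner ℝ x (A y)) :
    ∃ U : ℝ → RSpace n ≃ₗᵢ[ℝ] RSpace n, (∀ x, U 0 x = x) ∧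
      ∀ t x, HasDerivAt (fun t => U t x) (A (U t x)) t := by
  have hskew : A ∈ skewAdjoint (RSpace n →L[ℝ] RSpace n) := by
    rw [skewAdjoint.mem_iff, ContinuousLinearMap.star_eq_adjoint]
    refine ContinuousLinearMap.ext fun x => ext_inner_right ℝ fun y => ?_
    rw [ContinuousLinearMap.adjoint_inner_left, neg_apply, inner_neg_left, hA,
      neg_neg]
  have h0 : (0 : ℝ) • A = 0 := zero_smul ℝ A
  let _ : NormedAlgebra ℚ (RSpace n →L[ℝ] RSpace n) := NormedAlgebra.restrictScalars ℚ ℝ _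
  have hu : ∀ t : ℝ, NormedSpace.exp (t • A) ∈ unitary (RSpace n →L[ℝ] RSpace n) := fun t =>
    NormedSpace.exp_mem_unitary_of_mem_skewAdjoint (skewAdjoint.smul_mem t hskew)
  refine ⟨fun t => Unitary.linearIsometryEquiv ⟨_, hu t⟩, fun x => ?_, fun t x => ?_⟩
  · change NormedSpace.exp ((0 : ℝ) • A) x = x
    rw [h0, NormedSpace.exp_zero]
    rfl
  · change HasDerivAt (fun t : ℝ => NormedSpace.exp (t • A) x)
      (A (NormedSpace.exp (t • A) x)) t
    have h := (hasDerivAt_exp_smul_const' (𝕂 := ℝ) A t).clm_apply (hasDerivAt_const t x)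
    simpa using h

/-- The integral of `h ∘ U t` does not depend on `t`, and its derivative at `t = 0` is the integral
of `rotDeriv A h`. Compactness of the sphere supplies the dominating constant. -/
theorem integral_rotDeriv_eq_zero (hr : 0 < r) (A : RSpace n →L[ℝ] RSpace n)
    (hA : ∀ x y, inner ℝ (A x) y = - inner ℝ x (A y)) {h : RSpace n → ℝ}
    (hh : ContDiffOn ℝ ∞ h {0}ᶜ) :
    ∫ x : RoundSphere n r, rotDeriv A h x ∂(sphereVolume n hr.le) = 0 := by
  obtain ⟨U, hU0, hU⟩ := exists_rotation_flow A hA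
  have hcont := continuous_restrict_of_contDiffOn hr hh
  have hcont' := continuous_restrict_of_contDiffOn hr (contDiffOn_rotDeriv A hh)
  obtain ⟨C, hC⟩ := isCompact_univ.exists_bound_of_continuousOn
    (f := fun x : RoundSphere n r => rotDeriv A h x) hcont'.continuousOn
  have hd : ∀ (x : RoundSphere n r) (t : ℝ), HasDerivAt (fun t => h (sphereIsometry (U t) x))
      (rotDeriv A h (sphereIsometry (U t) x)) t := by
    intro x t
    have h1 : DifferentiableAt ℝ h (U t x) :=
      (hh.contDiffAt (isOpen_compl_singleton.mem_nhds
        ((sphereIsometry (U t) x).coe_ne_zero hr))).differentiableAt (by simp)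
    exact h1.hasFDerivAt.comp_hasDerivAt t (hU t x)
  have h2 := (hasDerivAt_integral_of_dominated_loc_of_deriv_le (μ := sphereVolume n hr.le)
    (F := fun t x => h (sphereIsometry (U t) x))
    (F' := fun t x => rotDeriv A h (sphereIsometry (U t) x)) (x₀ := (0 : ℝ))
    (bound := fun _ => C) (s := Set.univ) Filter.univ_mem
    (Filter.Eventually.of_forall fun t =>
      (hcont.comp (continuous_sphereIsometry (U t))).aestronglyMeasurable)
    ((hcont.comp (continuous_sphereIsometry (U 0))).integrable_sphereVolume hr.le)
    (hcont'.comp (continuous_sphereIsometry (U 0))).aestronglyMeasurable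
    (Filter.Eventually.of_forall fun x t _ => hC _ (Set.mem_univ _)) (integrable_const C)
    (Filter.Eventually.of_forall fun x t _ => hd x t)).2
  have h3 : (fun t => ∫ x, h (sphereIsometry (U t) x) ∂(sphereVolume n hr.le))
      = fun _ => ∫ x : RoundSphere n r, h x ∂(sphereVolume n hr.le) := by
    funext t
    exact integral_comp_sphereIsometry hr.le (U t) hcont
  have h4 : ∀ x : RoundSphere n r, sphereIsometry (U 0) x = x := fun x => Subtype.ext (hU0 x)
  simp only [h3, h4] at h2
  exact h2.unique (hasDerivAt_const _ _)

/-- The integrand is the `A`-derivative of `F · AG - G · AF`, since the products `AF · AG` cancel.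
-/
theorem integral_rotDeriv_rotDeriv_sub (hr : 0 < r) (A : RSpace n →L[ℝ] RSpace n)
    (hA : ∀ x y, inner ℝ (A x) y = - inner ℝ x (A y)) {F G : RSpace n → ℝ}
    (hF : ContDiffOn ℝ ∞ F {0}ᶜ) (hG : ContDiffOn ℝ ∞ G {0}ᶜ) :
    ∫ x : RoundSphere n r, (F x * rotDeriv A (rotDeriv A G) x
      - G x * rotDeriv A (rotDeriv A F) x) ∂(sphereVolume n hr.le) = 0 := by
  have hF' := contDiffOn_rotDeriv A hF
  have hG' := contDiffOn_rotDeriv A hG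
  refine Eq.trans ?_ (integral_rotDeriv_eq_zero hr A hA ((hF.mul hG').sub (hG.mul hF')))
  refine integral_congr_ae (Filter.Eventually.of_forall fun x => ?_)
  have hd : ∀ {K : RSpace n → ℝ}, ContDiffOn ℝ ∞ K {0}ᶜ →
      HasFDerivAt K (fderiv ℝ K x) (x : RSpace n) := fun hK =>
    ((hK.contDiffAt (isOpen_compl_singleton.mem_nhds (x.coe_ne_zero hr))).differentiableAt
      (by simp)).hasFDerivAt
  have h := ((hd hF).mul (hd hG')).sub ((hd hG).mul (hd hF'))
  simp only [rotDeriv] at h ⊢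
  erw [h.fderiv]
  simp
  ring

/-- The infinitesimal rotation in the coordinate plane `(i, j)`. -/
noncomputable def planeRot (i j : Fin n) : RSpace n →L[ℝ] RSpace n :=
  (EuclideanSpace.proj i).smulRight (stdVec j) - (EuclideanSpace.proj j).smulRight (stdVec i)

theorem planeRot_apply (i j : Fin n) (x : RSpace n) :
    planeRot i j x = x i • stdVec j - x j • stdVec i := by
  simp [planeRot]

theorem inner_planeRot (i j : Fin n) (x y : RSpace n) :
    inner ℝ (planeRot i j x) y = - inner ℝ x (planeRot i j y) := by
  simp only [planeRot_apply, inner_sub_left, inner_sub_right, real_inner_smul_left,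
    real_inner_smul_right]
  simp [EuclideanSpace.inner_single_left, EuclideanSpace.inner_single_right]
  ring

theorem rotDeriv_rotDeriv (A : RSpace n →L[ℝ] RSpace n) {G : RSpace n → ℝ}
    (hG : ContDiffOn ℝ ∞ G {0}ᶜ) {x : RSpace n} (hx : x ≠ 0) :
    rotDeriv A (rotDeriv A G) x
      = fderiv ℝ (fderiv ℝ G) x (A x) (A x) + fderiv ℝ G x (A (A x)) := by
  have hdd : DifferentiableAt ℝ (fderiv ℝ G) x :=
    ((hG.contDiffAt (isOpen_compl_singleton.mem_nhds hx)).fderiv_right (m := 1)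
      (by norm_cast)).differentiableAt (by simp)
  have h := hdd.hasFDerivAt.clm_apply (A.hasFDerivAt (x := x))
  rw [rotDeriv]
  erw [h.fderiv]
  simp [add_comm]

/-- The Casimir element of the rotation algebra in Cartesian form. The factor `2` appears because
the sum over ordered pairs meets each coordinate plane twice. -/
theorem sum_rotDeriv_rotDeriv {G : RSpace n → ℝ} (hG : ContDiffOn ℝ ∞ G {0}ᶜ) {x : RSpace n}
    (hx : x ≠ 0) :
    ∑ i, ∑ j, rotDeriv (planeRot i j) (rotDeriv (planeRot i j) G) x
      = 2 * (‖x‖ ^ 2 * ∑ j, fderiv ℝ (fderiv ℝ G) x (stdVec j) (stdVec j)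
        - fderiv ℝ (fderiv ℝ G) x x x - (n - 1) * fderiv ℝ G x x) := by
  set H := fderiv ℝ (fderiv ℝ G) x with hH
  set L := fderiv ℝ G x with hL
  have h1 : H x x = ∑ i, ∑ j, x i * x j * H (stdVec i) (stdVec j) := by
    conv_lhs => rw [← sum_smul_stdVec x]
    simp [map_sum, Finset.mul_sum, mul_assoc]
    rw [Finset.sum_comm]
    refine Finset.sum_congr rfl fun i _ => Finset.sum_congr rfl fun j _ => by ring
  have h2 : L x = ∑ i, x i * L (stdVec i) := by
    conv_lhs => rw [← sum_smul_stdVec x]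
    simp [map_sum]
  -- For `i ≠ j` the square of the rotation sends `x` to `-xᵢ eᵢ - xⱼ eⱼ`; the `if` terms undo this
  -- on the diagonal, where the rotation is zero.
  have h3 : ∀ i j, rotDeriv (planeRot i j) (rotDeriv (planeRot i j) G) x
      = x i ^ 2 * H (stdVec j) (stdVec j) + x j ^ 2 * H (stdVec i) (stdVec i)
        - x j * x i * H (stdVec j) (stdVec i) - x i * x j * H (stdVec i) (stdVec j)
        + ((if i = j then x i * L (stdVec j) else 0) + (if i = j then x j * L (stdVec i) else 0)
          - x j * L (stdVec j) - x i * L (stdVec i)) := by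
    intro i j
    rw [rotDeriv_rotDeriv _ hG hx, ← hH, ← hL]
    simp only [planeRot_apply, map_sub, map_smul, sub_apply,
      smul_apply, smul_eq_mul]
    rcases eq_or_ne i j with rfl | hij
    · simp; ring
    · simp [hij, hij.symm]; ring
  simp_rw [h3, Finset.sum_add_distrib, Finset.sum_sub_distrib, Finset.sum_add_distrib]
  rw [Finset.sum_comm (f := fun i j => x j * x i * H (stdVec j) (stdVec i)), ← h1]
  simp only [Finset.sum_ite_eq, Finset.mem_univ, if_true, Finset.sum_const, Finset.card_univ,
    Fintype.card_fin, ← Finset.mul_sum, ← Finset.sum_mul, ← h2, nsmul_eq_mul]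
  rw [EuclideanSpace.real_norm_sq_eq]
  ring

theorem sphereLaplacian_eq_sum_rotDeriv (hr : 0 < r) {f : RoundSphere n r → ℝ}
    {G : RSpace n → ℝ} (h : ∀ y : RoundSphere n r, f y = G y) (hG : ContDiffOn ℝ ∞ G {0}ᶜ)
    (x : RoundSphere n r) :
    sphereLaplacian f x = -(1 / (2 * r ^ 2)) *
      ∑ i, ∑ j, rotDeriv (planeRot i j) (rotDeriv (planeRot i j) G) x := by
  rw [sphereLaplacian_eq hr h hG, sum_rotDeriv_rotDeriv hG (x.coe_ne_zero hr), x.norm_eq]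
  field_simp

/-- The Laplacian on functions on the sphere is symmetric for the `L²` inner product. -/
theorem integral_mul_sphereLaplacian_sub (hr : 0 < r) {f g : RoundSphere n r → ℝ}
    (hf : SphereSmooth f) (hg : SphereSmooth g) :
    ∫ x, (f x * sphereLaplacian g x - g x * sphereLaplacian f x) ∂(sphereVolume n hr.le) = 0 := by
  set F := radialExtend f
  set G := radialExtend g
  have hfF : ∀ y : RoundSphere n r, f y = F y := fun y => (radialExtend_coe hr f y).symm
  have hgG : ∀ y : RoundSphere n r, g y = G y := fun y => (radialExtend_coe hr g y).symm
  have hF : ContDiffOn ℝ ∞ F {0}ᶜ := hf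
  have hG : ContDiffOn ℝ ∞ G {0}ᶜ := hg
  have h1 : ∀ x : RoundSphere n r, f x * sphereLaplacian g x - g x * sphereLaplacian f x
      = -(1 / (2 * r ^ 2)) * ∑ i, ∑ j, (F x * rotDeriv (planeRot i j) (rotDeriv (planeRot i j) G) x
        - G x * rotDeriv (planeRot i j) (rotDeriv (planeRot i j) F) x) := by
    intro x
    rw [sphereLaplacian_eq_sum_rotDeriv hr hfF hF, sphereLaplacian_eq_sum_rotDeriv hr hgG hG,
      hfF, hgG]
    simp only [Finset.sum_sub_distrib, ← Finset.mul_sum]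
    ring
  have hint : ∀ i j, Integrable (fun x : RoundSphere n r =>
      F x * rotDeriv (planeRot i j) (rotDeriv (planeRot i j) G) x
        - G x * rotDeriv (planeRot i j) (rotDeriv (planeRot i j) F) x) (sphereVolume n hr.le) :=
    fun i j => (continuous_restrict_of_contDiffOn hr
      ((hF.mul (contDiffOn_rotDeriv _ (contDiffOn_rotDeriv _ hG))).sub
        (hG.mul (contDiffOn_rotDeriv _ (contDiffOn_rotDeriv _ hF))))).integrable_sphereVolume hr.le
  simp_rw [h1]
  rw [integral_const_mul, integral_finsetSum _ fun i _ => integrable_finsetSum _ fun j _ => hint i j]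
  rw [Finset.sum_eq_zero fun i _ => ?_, mul_zero]
  rw [integral_finsetSum _ fun j _ => hint i j]
  exact Finset.sum_eq_zero fun j _ =>
    integral_rotDeriv_rotDeriv_sub hr _ (inner_planeRot i j) hF hG

end SphereMeasure

/-! ### The first positive eigenvalue and its eigenfunctions. -/

section SphereSpectrum

variable {n : ℕ} {r : ℝ}

theorem hasFDerivAt_comp_inner {φ φ' : ℝ → ℝ} (h : ∀ t, HasDerivAt φ (φ' t) t) (u x : RSpace n) :
    HasFDerivAt (fun x : RSpace n => φ (inner ℝ u x)) (φ' (inner ℝ u x) • innerSL ℝ u) x :=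
  (h _).comp_hasFDerivAt x ((innerSL ℝ u).hasFDerivAt (x := x))

theorem sphereSmooth_comp_inner (hr : 0 < r) {φ : ℝ → ℝ} (h : ContDiff ℝ ∞ φ) (u : RSpace n) :
    SphereSmooth (fun x : RoundSphere n r => φ (inner ℝ u (x : RSpace n))) :=
  sphereSmooth_of_contDiffOn (G := fun x : RSpace n => φ (inner ℝ u x)) hr (fun _ => rfl)
    (h.comp (innerSL ℝ u).contDiff).contDiffOn

theorem sphereLaplacian_comp_inner (hr : 0 < r) {φ φ' φ'' : ℝ → ℝ} (hφ : ContDiff ℝ ∞ φ)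
    (h : ∀ t, HasDerivAt φ (φ' t) t) (h' : ∀ t, HasDerivAt φ' (φ'' t) t) (u : RSpace n)
    (x : RoundSphere n r) :
    sphereLaplacian (fun x : RoundSphere n r => φ (inner ℝ u (x : RSpace n))) x
      = (φ'' (inner ℝ u (x : RSpace n)) * (inner ℝ u (x : RSpace n)) ^ 2
        + (n - 1) * φ' (inner ℝ u (x : RSpace n)) * inner ℝ u (x : RSpace n)) / r ^ 2
        - φ'' (inner ℝ u (x : RSpace n)) * ‖u‖ ^ 2 := by
  rw [sphereLaplacian_eq (G := fun x : RSpace n => φ (inner ℝ u x)) hr (fun _ => rfl)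
    (hφ.comp (innerSL ℝ u).contDiff).contDiffOn]
  have h1 : fderiv ℝ (fun x : RSpace n => φ (inner ℝ u x))
      = fun x => φ' (inner ℝ u x) • innerSL ℝ u :=
    funext fun x => (hasFDerivAt_comp_inner h u x).fderiv
  have h2 : ∀ x : RSpace n, fderiv ℝ (fun x : RSpace n => φ' (inner ℝ u x) • innerSL ℝ u) x
      = (φ'' (inner ℝ u x) • innerSL ℝ u).smulRight (innerSL ℝ u) := fun x =>
    ((hasFDerivAt_comp_inner h' u x).smul_const (innerSL ℝ u)).fderiv
  rw [h1, h2]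
  simp [EuclideanSpace.inner_single_right]
  rw [EuclideanSpace.real_norm_sq_eq, Finset.mul_sum]
  simp only [mul_assoc, ← pow_two]
  ring

theorem sphereLaplacian_inner (hr : 0 < r) (u : RSpace n) (x : RoundSphere n r) :
    sphereLaplacian (fun x : RoundSphere n r => inner ℝ u (x : RSpace n)) x
      = (n - 1) / r ^ 2 * inner ℝ u (x : RSpace n) := by
  rw [sphereLaplacian_comp_inner (φ := fun t => t) (φ' := fun _ => 1) (φ'' := fun _ => 0) hr
    contDiff_id hasDerivAt_id' (fun t => hasDerivAt_const t 1)]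
  ring

theorem sphereLaplacian_const (hr : 0 < r) (c : ℝ) (x : RoundSphere n r) :
    sphereLaplacian (fun _ : RoundSphere n r => c) x = 0 := by
  rw [sphereLaplacian_comp_inner (φ := fun _ => c) (φ' := fun _ => 0) (φ'' := fun _ => 0) hr
    contDiff_const (fun t => hasDerivAt_const t c) (fun t => hasDerivAt_const t 0) 0]
  ring

/-- The Laplacian is triangular on powers of a linear form and lowers the degree by two; this is the
engine of the two-step induction on moments. -/
theorem sphereLaplacian_inner_pow (hr : 0 < r) (u : RSpace n) (k : ℕ) (x : RoundSphere n r) :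
    sphereLaplacian (fun x : RoundSphere n r => (inner ℝ u (x : RSpace n)) ^ (k + 2)) x
      = (k + 2) * (k + n) / r ^ 2 * (inner ℝ u (x : RSpace n)) ^ (k + 2)
        - (k + 2) * (k + 1) * ‖u‖ ^ 2 * (inner ℝ u (x : RSpace n)) ^ k := by
  rw [sphereLaplacian_comp_inner (φ := fun t => t ^ (k + 2)) (φ' := fun t => (k + 2) * t ^ (k + 1))
    (φ'' := fun t => (k + 2) * ((k + 1) * t ^ k)) hr (contDiff_id.pow _)
    (fun t => by simpa using hasDerivAt_pow (k + 2) t)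
    (fun t => by simpa using (hasDerivAt_pow (k + 1) t).const_mul ((k : ℝ) + 2))]
  ring

theorem sphereLaplacian_sub (hr : 0 < r) {f g : RoundSphere n r → ℝ} (hf : SphereSmooth f)
    (hg : SphereSmooth g) (x : RoundSphere n r) :
    sphereLaplacian (fun y => f y - g y) x = sphereLaplacian f x - sphereLaplacian g x := by
  have hx := isOpen_compl_singleton.mem_nhds (x.coe_ne_zero hr)
  have hfF : ∀ y : RoundSphere n r, f y = radialExtend f y := fun y => (radialExtend_coe hr f y).symm
  have hgG : ∀ y : RoundSphere n r, g y = radialExtend g y := fun y => (radialExtend_coe hr g y).symm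
  have hd : ∀ {f : RoundSphere n r → ℝ}, SphereSmooth f → ∀ y : RSpace n, y ∈ ({0}ᶜ : Set _) →
      DifferentiableAt ℝ (radialExtend f) y := fun hf y hy =>
    (ContDiffOn.contDiffAt hf (isOpen_compl_singleton.mem_nhds hy)).differentiableAt (by simp)
  have hdd : ∀ {f : RoundSphere n r → ℝ}, SphereSmooth f →
      DifferentiableAt ℝ (fderiv ℝ (radialExtend f)) x := fun hf =>
    ((ContDiffOn.contDiffAt hf hx).fderiv_right (m := 1) (by norm_cast)).differentiableAt (by simp)
  have h1 : ∀ y ∈ ({0}ᶜ : Set (RSpace n)), fderiv ℝ (fun y => radialExtend f y - radialExtend g y) y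
      = fderiv ℝ (radialExtend f) y - fderiv ℝ (radialExtend g) y := fun y hy =>
    fderiv_fun_sub (hd hf y hy) (hd hg y hy)
  have h2 : fderiv ℝ (fderiv ℝ (fun y => radialExtend f y - radialExtend g y)) (x : RSpace n)
      = fderiv ℝ (fderiv ℝ (radialExtend f)) x - fderiv ℝ (fderiv ℝ (radialExtend g)) x := by
    rw [(Filter.eventuallyEq_of_mem hx h1).fderiv_eq]
    exact fderiv_sub (hdd hf) (hdd hg)
  rw [sphereLaplacian_eq (G := fun y => radialExtend f y - radialExtend g y) hr
    (fun y => by rw [hfF, hgG]) (ContDiffOn.sub hf hg), sphereLaplacian_eq hr hfF hf,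
    sphereLaplacian_eq hr hgG hg, h2, h1 _ (x.coe_ne_zero hr)]
  simp only [sub_apply, Finset.sum_sub_distrib]
  ring

theorem SphereSmooth.sub (hr : 0 < r) {f g : RoundSphere n r → ℝ} (hf : SphereSmooth f)
    (hg : SphereSmooth g) : SphereSmooth fun y => f y - g y :=
  sphereSmooth_of_contDiffOn (G := fun y => radialExtend f y - radialExtend g y) hr
    (fun y => by rw [radialExtend_coe hr, radialExtend_coe hr]) (ContDiffOn.sub hf hg)

/-- A continuous function on the sphere that is orthogonal to all powers of linear functions
vanishes. -/
theorem eq_zero_of_integral_mul_inner_pow_eq_zero (ν : Measure (RoundSphere n r))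
    [IsFiniteMeasure ν] [ν.IsOpenPosMeasure] {f : RoundSphere n r → ℝ} (hf : Continuous f)
    (h : ∀ (u : RSpace n) (k : ℕ), ∫ x, f x * (inner ℝ u (x : RSpace n)) ^ k ∂ν = 0) : f = 0 := by
  have hint : ∀ {g : RoundSphere n r → ℝ}, Continuous g → Integrable g ν := fun hg =>
    hg.integrable_of_hasCompactSupport (HasCompactSupport.of_compactSpace _)
  let T₀ : C(RoundSphere n r, ℝ) →ₗ[ℝ] ℝ :=
    { toFun := fun φ => ∫ x, f x * φ x ∂ν
      map_add' := fun φ φ' => by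
        simp only [ContinuousMap.add_apply, mul_add]
        exact integral_add (hint (hf.mul φ.continuous)) (hint (hf.mul φ'.continuous))
      map_smul' := fun c φ => by
        simp only [ContinuousMap.smul_apply, smul_eq_mul, RingHom.id_apply]
        rw [← integral_const_mul]
        congr 1; funext x; ring }
  let T : C(RoundSphere n r, ℝ) →L[ℝ] ℝ := T₀.mkContinuous (∫ x, |f x| ∂ν) fun φ => by
    rw [← integral_mul_const]
    refine norm_integral_le_of_norm_le (hint (hf.abs.mul continuous_const)) ?_
    refine Filter.Eventually.of_forall fun x => ?_
    rw [norm_mul, Real.norm_eq_abs]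
    exact mul_le_mul_of_nonneg_left (φ.norm_coe_le_norm x) (abs_nonneg _)
  have hT : ∀ φ, T φ = ∫ x, f x * φ x ∂ν := fun φ => rfl
  let q : RSpace n → C(RoundSphere n r, ℝ) := fun u =>
    ⟨fun x => inner ℝ u (x : RSpace n), by fun_prop⟩
  let _ : NormedAlgebra ℚ C(RoundSphere n r, ℝ) := NormedAlgebra.restrictScalars ℚ ℝ _
  -- `T` is continuous, so it may be applied termwise to the exponential series, each term of which
  -- is a power of `⟨u, ·⟩`.
  have hexp : ∀ u, T (NormedSpace.exp (q u)) = 0 := by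
    intro u
    have h1 := (NormedSpace.exp_series_hasSum_exp' (𝕂 := ℝ) (q u)).mapL T
    refine h1.unique ?_
    have : (fun k : ℕ => T (((k.factorial : ℝ)⁻¹) • q u ^ k)) = fun _ => 0 := by
      funext k
      rw [map_smul, hT]
      exact (congrArg _ (h u k)).trans (smul_zero _)
    rw [this]
    exact hasSum_zero
  -- Exponentials of linear forms are closed under products, so the algebra they generate is their
  -- linear span and `T` vanishes on it. This avoids polarising powers into products of distinct
  -- linear forms.
  let M : Submonoid C(RoundSphere n r, ℝ) :=
    { carrier := Set.range fun u => NormedSpace.exp (q u)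
      one_mem' := ⟨0, by
        have : q 0 = 0 := by ext x; simp [q]
        simp [this]⟩
      mul_mem' := by
        rintro _ _ ⟨u, rfl⟩ ⟨v, rfl⟩
        refine ⟨u + v, ?_⟩
        have : q (u + v) = q u + q v := by ext x; simp [q, inner_add_left]
        simp only [this]
        exact NormedSpace.exp_add }
  let S : Subalgebra ℝ C(RoundSphere n r, ℝ) := Algebra.adjoin ℝ (M : Set C(RoundSphere n r, ℝ))
  have hS : (S : Set C(RoundSphere n r, ℝ)) ⊆ T ⁻¹' {0} := by
    intro φ hφ
    have h1 : φ ∈ Submodule.span ℝ (M : Set C(RoundSphere n r, ℝ)) := by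
      have h2 : φ ∈ Subalgebra.toSubmodule S := hφ
      rwa [Algebra.adjoin_eq_span, Submonoid.closure_eq] at h2
    have h3 : Submodule.span ℝ (M : Set C(RoundSphere n r, ℝ)) ≤ LinearMap.ker T.toLinearMap := by
      rw [Submodule.span_le]
      rintro _ ⟨u, rfl⟩
      exact hexp u
    exact h3 h1
  have hsep : S.SeparatesPoints := by
    intro x y hxy
    have hxy' : (x : RSpace n) ≠ y := fun h => hxy (Subtype.ext h)
    -- The form `⟨x - y, ·⟩` separates `x` from `y`: its values there differ by `‖x - y‖²`.
    refine ⟨_, ⟨_, Algebra.subset_adjoin ⟨(x : RSpace n) - y, rfl⟩, rfl⟩, ?_⟩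
    have hev : ∀ z : RoundSphere n r, NormedSpace.exp (q ((x : RSpace n) - y)) z
        = Real.exp (inner ℝ ((x : RSpace n) - y) (z : RSpace n)) := by
      intro z
      have h1 := NormedSpace.map_exp (ContinuousMap.evalAlgHom ℝ ℝ z)
        (continuous_eval_const z) (q ((x : RSpace n) - y))
      rw [Real.exp_eq_exp_ℝ]
      exact h1
    simp only [hev]
    intro h1
    have h2 := Real.exp_injective h1
    have h3 : inner ℝ ((x : RSpace n) - y) ((x : RSpace n) - y) = 0 := by
      rw [inner_sub_right, h2, sub_self]
    exact hxy' (sub_eq_zero.1 (inner_self_eq_zero.1 h3))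
  have htop := ContinuousMap.subalgebra_topologicalClosure_eq_top_of_separatesPoints S hsep
  have hall : ∀ φ, T φ = 0 := by
    intro φ
    have h1 : φ ∈ S.topologicalClosure := by rw [htop]; trivial
    have h2 : φ ∈ closure (S : Set C(RoundSphere n r, ℝ)) := h1
    exact closure_minimal hS (isClosed_singleton.preimage T.continuous) h2
  have hff : ∫ x, f x * f x ∂ν = 0 := hall ⟨f, hf⟩
  rw [integral_eq_zero_iff_of_nonneg (fun x => mul_self_nonneg _) (hint (hf.mul hf))] at hff
  have hz := Continuous.ae_eq_iff_eq ν (hf.mul hf) continuous_zero |>.1 hff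
  funext x
  exact mul_self_eq_zero.1 (congrFun hz x)

/-- An eigenfunction with positive eigenvalue at most `(n - 1) / r²` that is orthogonal to the
linear functions (or belongs to an eigenvalue smaller than `(n - 1) / r²`) vanishes. -/
theorem eq_zero_of_sphereLaplacian_eq (hr : 0 < r) (hn : 0 < n) {f : RoundSphere n r → ℝ}
    (hf : SphereSmooth f) {μ : ℝ} (hμ : 0 < μ) (hμ' : μ ≤ (n - 1) / r ^ 2)
    (he : ∀ x, sphereLaplacian f x = μ * f x)
    (hlin : μ = (n - 1) / r ^ 2 →
      ∀ u : RSpace n, ∫ x, f x * inner ℝ u (x : RSpace n) ∂(sphereVolume n hr.le) = 0) :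
    f = 0 := by
  have := isOpenPosMeasure_sphereVolume (n := n) hr
  have hfc := hf.continuous hr
  -- Symmetry tested on `f` and `g`: when `c ≠ μ`, the integral of `f g` is controlled by that of `f
  -- g'`.
  have key : ∀ {g g' : RoundSphere n r → ℝ} {c : ℝ}, SphereSmooth g → Continuous g' →
      (∀ x, sphereLaplacian g x = c * g x - g' x) →
      (c - μ) * ∫ x, f x * g x ∂(sphereVolume n hr.le)
        = ∫ x, f x * g' x ∂(sphereVolume n hr.le) := by
    intro g g' c hg hg' hgl
    have h1 := integral_mul_sphereLaplacian_sub hr hf hg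
    have h2 : ∀ x, f x * sphereLaplacian g x - g x * sphereLaplacian f x
        = (c - μ) * (f x * g x) - f x * g' x := fun x => by rw [hgl, he]; ring
    simp_rw [h2] at h1
    rw [integral_sub (((hfc.fun_mul (hg.continuous hr)).integrable_sphereVolume hr.le).const_mul _)
      ((hfc.fun_mul hg').integrable_sphereVolume hr.le), integral_const_mul] at h1
    exact sub_eq_zero.1 h1
  have hpow : ∀ (u : RSpace n) (k : ℕ),
      SphereSmooth (fun x : RoundSphere n r => (inner ℝ u (x : RSpace n)) ^ k) := fun u k =>
    sphereSmooth_comp_inner (φ := fun t => t ^ k) hr (contDiff_id.pow k) u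
  refine eq_zero_of_integral_mul_inner_pow_eq_zero (sphereVolume n hr.le) hfc fun u k => ?_
  induction k using Nat.twoStepInduction with
  | zero =>
    have h := key (g := fun _ => 1) (g' := fun _ => 0) (c := 0) (by simpa using hpow 0 0)
      continuous_const (fun x => by rw [sphereLaplacian_const hr]; ring)
    simpa [hμ.ne'] using h
  | one =>
    simp only [pow_one]
    -- Degree one is the only degree whose coefficient can equal `μ`; there orthogonality has to be
    -- assumed.
    rcases eq_or_ne μ ((n - 1) / r ^ 2) with h | h
    · exact hlin h u
    have h1 := key (g := fun x => inner ℝ u (x : RSpace n)) (g' := fun _ => 0)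
      (c := (n - 1) / r ^ 2) (by simpa using hpow u 1) continuous_const
      (fun x => by rw [sphereLaplacian_inner hr]; ring)
    simp only [mul_zero, integral_zero] at h1
    exact (mul_eq_zero.1 h1).resolve_left (sub_ne_zero.2 h.symm)
  | more k ih _ =>
    have h1 := key (hpow u (k + 2)) (continuous_const.fun_mul ((hpow u k).continuous hr))
      (sphereLaplacian_inner_pow hr u k)
    have h2 : ∀ x : RoundSphere n r, f x * ((k + 2) * (k + 1) * ‖u‖ ^ 2 *
        (inner ℝ u (x : RSpace n)) ^ k)
        = ((k + 2) * (k + 1) * ‖u‖ ^ 2) * (f x * (inner ℝ u (x : RSpace n)) ^ k) := fun x => by ring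
    simp_rw [h2] at h1
    rw [integral_const_mul, ih, mul_zero] at h1
    -- The coefficient `(k + 2)(k + n) / r²` exceeds `(n - 1) / r²`, hence also `μ`.
    refine (mul_eq_zero.1 h1).resolve_left (sub_pos.2 (hμ'.trans_lt ?_)).ne'
    refine div_lt_div_of_pos_right ?_ (by positivity)
    have hk : (0 : ℝ) ≤ k := k.cast_nonneg
    have hn' : (0 : ℝ) < n := Nat.cast_pos.2 hn
    nlinarith [mul_nonneg hk hk, mul_nonneg hk hn'.le]

/-- The Laplacian of `⟨u, x⟩²` is `(2n / r²) ⟨u, x⟩² - 2 ‖u‖²` and integrates to zero by symmetry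
against the constant `1`. Polarisation gives the mixed moment. -/
theorem integral_inner_mul_inner_sphere (hr : 0 < r) (hn : 0 < n) (u v : RSpace n) :
    ∫ x : RoundSphere n r, inner ℝ u (x : RSpace n) * inner ℝ v (x : RSpace n)
      ∂(sphereVolume n hr.le) = inner ℝ u v * (r ^ 2 / n * (sphereVolume n hr.le).real Set.univ) := by
  have hint : ∀ {g : RoundSphere n r → ℝ}, Continuous g → Integrable g (sphereVolume n hr.le) :=
    fun hg => hg.integrable_sphereVolume hr.le
  have hc : ∀ u : RSpace n, Continuous fun x : RoundSphere n r => inner ℝ u (x : RSpace n) :=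
    fun u => by fun_prop
  have hn' : (n : ℝ) ≠ 0 := Nat.cast_ne_zero.2 hn.ne'
  have hsq : ∀ u : RSpace n, ∫ x : RoundSphere n r, (inner ℝ u (x : RSpace n)) ^ 2
      ∂(sphereVolume n hr.le) = ‖u‖ ^ 2 * (r ^ 2 / n * (sphereVolume n hr.le).real Set.univ) := by
    intro u
    have h1 := integral_mul_sphereLaplacian_sub (n := n) hr
      (sphereSmooth_comp_inner (φ := fun _ => 1) hr contDiff_const 0)
      (sphereSmooth_comp_inner (φ := fun t => t ^ (0 + 2)) hr (contDiff_id.pow _) u)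
    have h2 : ∀ x : RoundSphere n r, 1 * sphereLaplacian (fun x : RoundSphere n r =>
        (inner ℝ u (x : RSpace n)) ^ (0 + 2)) x - (inner ℝ u (x : RSpace n)) ^ (0 + 2) *
        sphereLaplacian (fun _ : RoundSphere n r => (1 : ℝ)) x
        = (2 * n / r ^ 2) * (inner ℝ u (x : RSpace n)) ^ 2 - 2 * ‖u‖ ^ 2 := fun x => by
      rw [sphereLaplacian_inner_pow hr, sphereLaplacian_const hr]; simp
    simp_rw [h2] at h1
    rw [integral_sub ((hint ((hc u).fun_pow 2)).const_mul _) (integrable_const _), integral_const_mul,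
      integral_const, smul_eq_mul] at h1
    field_simp at h1 ⊢
    linarith
  have h3 : ∀ x : RoundSphere n r, inner ℝ u (x : RSpace n) * inner ℝ v (x : RSpace n)
      = (1 / 2) * ((inner ℝ (u + v) (x : RSpace n)) ^ 2 - (inner ℝ u (x : RSpace n)) ^ 2
        - (inner ℝ v (x : RSpace n)) ^ 2) := fun x => by rw [inner_add_left]; ring
  simp_rw [h3]
  rw [integral_const_mul, integral_sub (hint (((hc _).fun_pow 2).fun_sub ((hc _).fun_pow 2)))
    (hint ((hc _).fun_pow 2)), integral_sub (hint ((hc _).fun_pow 2)) (hint ((hc _).fun_pow 2)),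
    hsq, hsq, hsq, norm_add_sq_real]
  ring

/-- The eigenfunctions of the Laplacian for the eigenvalue `(n - 1) / r²` on the sphere of radius
`r` in `ℝⁿ` are the linear functions. -/
theorem exists_eq_inner_of_sphereLaplacian_eq (hr : 0 < r) (hn : 1 < n)
    {f : RoundSphere n r → ℝ} (hf : SphereSmooth f)
    (he : ∀ x, sphereLaplacian f x = (n - 1) / r ^ 2 * f x) :
    ∃ a : RSpace n, ∀ x : RoundSphere n r, f x = inner ℝ a (x : RSpace n) := by
  have := isOpenPosMeasure_sphereVolume (n := n) hr
  have hfc := hf.continuous hr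
  have hn' : (1 : ℝ) < n := by exact_mod_cast hn
  set c := r ^ 2 / n * (sphereVolume n hr.le).real Set.univ with hc
  have hcpos : 0 < c := by
    have : Nonempty (RoundSphere n r) :=
      ⟨⟨r • stdVec ⟨0, by omega⟩, by simp [norm_smul, abs_of_pos hr]⟩⟩
    have : 0 < (sphereVolume n hr.le).real Set.univ :=
      measureReal_univ_pos
    positivity
  have hint : Integrable (fun x : RoundSphere n r => f x • (x : RSpace n)) (sphereVolume n hr.le) :=
    (hfc.smul continuous_subtype_val).integrable_sphereVolume hr.le
  -- Since `c` is the second moment of a unit linear form, this choice makes `f - ⟨a, ·⟩` orthogonal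
  -- to every linear form.
  set a : RSpace n := c⁻¹ • ∫ x, f x • (x : RSpace n) ∂(sphereVolume n hr.le) with ha
  have hau : ∀ u : RSpace n, c * inner ℝ a u
      = ∫ x, f x * inner ℝ u (x : RSpace n) ∂(sphereVolume n hr.le) := by
    intro u
    rw [ha, real_inner_smul_left, mul_inv_cancel_left₀ hcpos.ne', real_inner_comm,
      ← integral_inner hint]
    simp [real_inner_smul_right]
  have hlin := sphereSmooth_comp_inner (r := r) (φ := fun t => t) hr contDiff_id a
  have hc' : ∀ u : RSpace n, Continuous fun x : RoundSphere n r => inner ℝ u (x : RSpace n) :=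
    fun u => by fun_prop
  have hz := eq_zero_of_sphereLaplacian_eq hr (by omega) (SphereSmooth.sub hr hf hlin)
    (μ := (n - 1) / r ^ 2) (div_pos (by linarith) (by positivity)) le_rfl
    (fun x => by rw [sphereLaplacian_sub hr hf hlin, he, sphereLaplacian_inner hr]; ring)
    (fun _ u => by
      simp_rw [sub_mul]
      rw [integral_sub ((hfc.fun_mul (hc' u)).integrable_sphereVolume hr.le)
        (((hc' a).fun_mul (hc' u)).integrable_sphereVolume hr.le),
        integral_inner_mul_inner_sphere hr (by omega), ← hau]
      ring)
  exact ⟨a, fun x => sub_eq_zero.1 (congrFun hz x)⟩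

/-- The first positive eigenvalue of the Laplacian on the sphere of radius `r` in `ℝⁿ`. -/
theorem isLeast_sphereEigenvalue (hr : 0 < r) (hn : 1 < n) :
    IsLeast {μ : ℝ | 0 < μ ∧ IsSphereEigenvalue n r μ} ((n - 1) / r ^ 2) := by
  have hn' : (1 : ℝ) < n := by exact_mod_cast hn
  obtain ⟨u, x₀, hu⟩ : ∃ (u : RSpace n) (x : RoundSphere n r), inner ℝ u (x : RSpace n) ≠ 0 := by
    have hx : r • stdVec (⟨0, by omega⟩ : Fin n) ∈ Metric.sphere (0 : RSpace n) r := by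
      simp [norm_smul, abs_of_pos hr]
    refine ⟨_, ⟨_, hx⟩, fun h => (RoundSphere.coe_ne_zero hr ⟨_, hx⟩) (inner_self_eq_zero.1 h)⟩
  refine ⟨⟨div_pos (by linarith) (by positivity), ?_⟩, ?_⟩
  · exact ⟨fun x => inner ℝ u (x : RSpace n),
      sphereSmooth_comp_inner (φ := fun t => t) hr contDiff_id u,
      fun h => hu (congrFun h x₀), sphereLaplacian_inner hr u⟩
  · rintro μ ⟨hμ, f, hf, hne, he⟩
    by_contra! hlt
    exact hne (eq_zero_of_sphereLaplacian_eq hr (by omega) hf hμ hlt.le he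
      fun h => absurd h hlt.ne)

end SphereSpectrum

/-! ### The Hopf map, its gradient sections and their Jacobi operator. -/

section Hopf

/-- The symmetric bilinear map whose quadratic form is the Hopf map. -/
noncomputable def hopfBilin : RSpace 4 →L[ℝ] RSpace 4 →L[ℝ] RSpace 3 :=
  (LinearMap.mk₂ ℝ (fun x y : RSpace 4 => (1 / (2 * √2)) •
      (!₂[x 0 * y 2 + x 2 * y 0 + x 1 * y 3 + x 3 * y 1,
        x 1 * y 2 + x 2 * y 1 - x 0 * y 3 - x 3 * y 0,
        x 0 * y 0 + x 1 * y 1 - x 2 * y 2 - x 3 * y 3] : RSpace 3))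
    (by intro x x' y; ext i; fin_cases i <;> simp <;> ring)
    (by intro c x y; ext i; fin_cases i <;> simp <;> ring)
    (by intro x x' y; ext i; fin_cases i <;> simp <;> ring)
    (by intro c x y; ext i; fin_cases i <;> simp <;> ring)).toContinuousBilinearMap

theorem hopfBilin_apply (x y : RSpace 4) : hopfBilin x y = (1 / (2 * √2)) •
      (!₂[x 0 * y 2 + x 2 * y 0 + x 1 * y 3 + x 3 * y 1,
        x 1 * y 2 + x 2 * y 1 - x 0 * y 3 - x 3 * y 0,
        x 0 * y 0 + x 1 * y 1 - x 2 * y 2 - x 3 * y 3] : RSpace 3) := rfl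

theorem hopfBilin_comm (x y : RSpace 4) : hopfBilin x y = hopfBilin y x := by
  simp only [hopfBilin_apply]
  ext i; fin_cases i <;> simp <;> ring

theorem hopfMap_eq (x : RoundSphere 4 (√2)) :
    (hopfMap x : RSpace 3) = hopfBilin (x : RSpace 4) (x : RSpace 4) := by
  rw [hopfBilin_apply, hopfMap]
  ext i; fin_cases i <;> simp <;> ring

/-- The components of the Hopf map are trace-free quadratic forms, that is, harmonic polynomials;
harmonicity of the map rests on this. -/
theorem sum_hopfBilin_stdVec : ∑ j, hopfBilin (stdVec j) (stdVec j) = 0 := by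
  simp only [hopfBilin_apply, Fin.sum_univ_four]
  ext i; fin_cases i <;> simp

theorem inner_smul_hopf (v w : RSpace 3) :
    inner ℝ ((1 / (2 * √2)) • v) ((1 / (2 * √2)) • w) = (1 / 8) * inner ℝ v w := by
  have h : √2 * √2 = 2 := Real.mul_self_sqrt (by norm_num)
  rw [real_inner_smul_left, real_inner_smul_right, ← mul_assoc]
  congr 1
  field_simp
  nlinarith

/-- The derivative in `x` of the norm identity `‖B(x, x)‖² = ‖x‖⁴ / 8`, up to a factor. -/
theorem inner_hopfBilin_self (x y : RSpace 4) :
    inner ℝ (hopfBilin x x) (hopfBilin x y) = ‖x‖ ^ 2 / 8 * inner ℝ x y := by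
  rw [hopfBilin_apply, hopfBilin_apply, inner_smul_hopf, EuclideanSpace.real_norm_sq_eq]
  simp [PiLp.inner_apply, Fin.sum_univ_three, Fin.sum_univ_four]
  ring

/-- The derivative of `inner_hopfBilin_self` in the direction `y`. It trades the normal component of
`B(y, a)` for products of vectors `B(x, ·)`. -/
theorem inner_hopfBilin_add (x y a : RSpace 4) :
    2 * inner ℝ (hopfBilin x y) (hopfBilin x a) + inner ℝ (hopfBilin x x) (hopfBilin y a)
      = ‖x‖ ^ 2 / 8 * inner ℝ a y + inner ℝ x y * inner ℝ x a / 4 := by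
  simp only [hopfBilin_apply, inner_smul_hopf, EuclideanSpace.real_norm_sq_eq]
  simp [PiLp.inner_apply, Fin.sum_univ_three, Fin.sum_univ_four]
  ring

theorem sum_inner_hopfBilin_stdVec (x : RSpace 4) :
    ∑ j, inner ℝ (hopfBilin x (stdVec j)) (hopfBilin x (stdVec j)) = 3 / 8 * ‖x‖ ^ 2 := by
  simp only [hopfBilin_apply, inner_smul_hopf]
  simp only [real_inner_self_eq_norm_sq, EuclideanSpace.real_norm_sq_eq, Fin.sum_univ_four]
  simp [Fin.sum_univ_three]
  ring

/-- `B(x, ·)` composed with its adjoint is a multiple of the identity. With `‖x‖² = 2` this says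
that `2 B(x, ·)` is a coisometry, so the Hopf map is a Riemannian submersion. -/
theorem sum_inner_smul_hopfBilin_stdVec (x : RSpace 4) (w : RSpace 3) :
    ∑ j, inner ℝ (hopfBilin x (stdVec j)) w • hopfBilin x (stdVec j) = (‖x‖ ^ 2 / 8) • w := by
  have h : (√2)⁻¹ * (√2)⁻¹ = 1 / 2 := by
    rw [← mul_inv, Real.mul_self_sqrt (by norm_num)]; norm_num
  simp only [hopfBilin_apply, EuclideanSpace.real_norm_sq_eq, Fin.sum_univ_four,
    real_inner_smul_left, smul_smul]
  ext i
  fin_cases i <;> simp [PiLp.inner_apply, Fin.sum_univ_three] <;> grind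

theorem sqrt_two_pos : (0 : ℝ) < √2 := by positivity

theorem one_div_sqrt_two_pos : (0 : ℝ) < 1 / √2 := by positivity

theorem norm_sq_eq_two (x : RoundSphere 4 (√2)) : ‖(x : RSpace 4)‖ ^ 2 = 2 := by
  rw [x.norm_eq, Real.sq_sqrt (by norm_num)]

theorem hasFDerivAt_hopfBilin_self (x : RSpace 4) :
    HasFDerivAt (fun x => hopfBilin x x) ((2 : ℝ) • hopfBilin x) x := by
  refine (hopfBilin.hasFDerivAt.clm_apply (hasFDerivAt_id x)).congr_fderiv ?_
  ext1 v
  simp [two_smul, hopfBilin_comm v x]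

theorem mapDeriv_hopfMap (x : RoundSphere 4 (√2)) (X : RSpace 4) :
    mapDeriv hopfMap x X = (2 : ℝ) • hopfBilin (x : RSpace 4) (tangentProj x X) := by
  rw [mapDeriv, sphereDeriv_eq sqrt_two_pos hopfMap_eq
    (hasFDerivAt_hopfBilin_self _).differentiableAt, (hasFDerivAt_hopfBilin_self _).fderiv]
  simp [two_smul]

theorem contDiff_hopfBilin_self : ContDiff ℝ ∞ (fun x => hopfBilin x x) :=
  hopfBilin.contDiff.clm_apply contDiff_id

theorem tangentProj_hopfMap (x : RoundSphere 4 (√2)) (v : RSpace 3) :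
    tangentProj (hopfMap x) v = v - (2 * inner ℝ (hopfBilin (x : RSpace 4) (x : RSpace 4)) v) •
      hopfBilin (x : RSpace 4) (x : RSpace 4) := by
  rw [tangentProj_apply, hopfMap_eq, div_pow, Real.sq_sqrt (by norm_num)]
  congr 2
  ring

theorem tangentProj_hopfMap_self (x : RoundSphere 4 (√2)) :
    tangentProj (hopfMap x) (hopfBilin (x : RSpace 4) (x : RSpace 4)) = 0 := by
  rw [← hopfMap_eq, ← one_smul ℝ (hopfMap x : RSpace 3)]
  exact tangentProj_smul_self one_div_sqrt_two_pos _ _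

theorem inner_hopfBilin_of_inner_eq_zero (x : RoundSphere 4 (√2)) {X : RSpace 4}
    (hX : inner ℝ (x : RSpace 4) X = 0) :
    inner ℝ (hopfMap x : RSpace 3) (hopfBilin (x : RSpace 4) X) = 0 := by
  rw [hopfMap_eq, inner_hopfBilin_self, hX, mul_zero]

theorem tangentProj_hopfBilin (x : RoundSphere 4 (√2)) {X : RSpace 4}
    (hX : inner ℝ (x : RSpace 4) X = 0) :
    tangentProj (hopfMap x) (hopfBilin (x : RSpace 4) X) = hopfBilin (x : RSpace 4) X :=
  tangentProj_eq_self (inner_hopfBilin_of_inner_eq_zero x hX)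

theorem fderiv_projExtend_apply (x : RoundSphere 4 (√2)) {X Y : RSpace 4}
    (hY : inner ℝ (x : RSpace 4) Y = 0) :
    fderiv ℝ (fun y => projExtend (√2) y Y) (x : RSpace 4) X
      = -(inner ℝ X Y / 2) • (x : RSpace 4) := by
  rw [(hasFDerivAt_projExtend_const _ _ Y).fderiv]
  simp [hY, real_inner_comm, div_eq_inv_mul]

theorem projExtend_sqrt_two_self (x : RoundSphere 4 (√2)) {Y : RSpace 4}
    (hY : inner ℝ (x : RSpace 4) Y = 0) : projExtend (√2) (x : RSpace 4) Y = Y := by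
  rw [← tangentProj_eq_projExtend, tangentProj_eq_self hY]

/-- Differentiating `2 B(y, P_y Y)` gives `2 B(X, Y)` plus a multiple of `B(x, x)`, which is normal
to the target and projects to zero. -/
theorem secondFundForm_hopfMap (x : RoundSphere 4 (√2)) {X Y : RSpace 4}
    (hX : inner ℝ (x : RSpace 4) X = 0) (hY : inner ℝ (x : RSpace 4) Y = 0) :
    secondFundForm hopfMap x X Y = tangentProj (hopfMap x) ((2 : ℝ) • hopfBilin X Y) := by
  have hr := sqrt_two_pos
  have h1 : ∀ y : RoundSphere 4 (√2), mapDeriv hopfMap y (extendField (√2) Y y)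
      = (fun y : RSpace 4 => (2 : ℝ) • hopfBilin y (projExtend (√2) y Y)) (y : RSpace 4) := by
    intro y
    rw [mapDeriv_hopfMap, extendField, tangentProj_eq_self (inner_tangentProj hr y Y),
      tangentProj_eq_projExtend]
  have h2 : HasFDerivAt (fun y : RSpace 4 => (2 : ℝ) • hopfBilin y (projExtend (√2) y Y)) _
      (x : RSpace 4) := (hopfBilin.hasFDerivAt.clm_apply
        (hasFDerivAt_projExtend_const (√2) (x : RSpace 4) Y).differentiableAt.hasFDerivAt).const_smul
          (2 : ℝ)
  rw [secondFundForm, leviCivita_extendField_eq_zero hr x hX hY, map_zero, sub_zero, pullbackConn,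
    sphereDeriv_eq hr h1 h2.differentiableAt, h2.fderiv, tangentProj_eq_self hX]
  simp only [smul_apply, add_apply, ContinuousLinearMap.comp_apply, ContinuousLinearMap.flip_apply,
    fderiv_projExtend_apply x hY, projExtend_sqrt_two_self x hY, map_smul, smul_add, map_add,
    tangentProj_hopfMap_self, smul_zero, zero_add]

/-- The Hopf map is harmonic. -/
theorem isHarmonicSphereMap_hopfMap : IsHarmonicSphereMap hopfMap := by
  refine ⟨sphereSmooth_of_contDiffOn sqrt_two_pos hopfMap_eq
    contDiff_hopfBilin_self.contDiffOn, fun x => ?_⟩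
  rw [tensionField, tangentTrace_eq x _ (LinearMap.mk₂ ℝ
    (fun X Y : RSpace 4 => tangentProj (hopfMap x) ((2 : ℝ) • hopfBilin X Y))
    (by intros; simp only [map_add, map_smul, add_apply]; module)
    (by intros; simp only [map_smul, smul_apply]; module)
    (by intros; simp only [map_add, map_smul]; module)
    (by intros; simp only [map_smul]; module)) (fun X Y hX hY => secondFundForm_hopfMap x hX hY)]
  simp only [LinearMap.mk₂_apply, ← map_sum, ← Finset.smul_sum, sum_hopfBilin_stdVec, map_smul,
    tangentProj_hopfMap_self, map_zero, smul_zero, sub_zero]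

/-- The section `dψ(grad f)` for the linear function `f = ⟨a, ·⟩`, extended to `ℝ⁴`. -/
noncomputable def hopfSection (a x : RSpace 4) : RSpace 3 :=
  (2 : ℝ) • hopfBilin x a - (inner ℝ a x : ℝ) • hopfBilin x x

theorem sphereGrad_inner (x : RoundSphere 4 (√2)) (a : RSpace 4) {f : RoundSphere 4 (√2) → ℝ}
    (hf : ∀ y, f y = inner ℝ a (y : RSpace 4)) : sphereGrad f x = tangentProj x a := by
  have hr := sqrt_two_pos
  have h : gradient (radialExtend f) (x : RSpace 4) = tangentProj x a := by
    refine ext_inner_right ℝ fun v => ?_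
    have h1 := sphereDeriv_eq (G := innerSL ℝ a) hr hf
      (innerSL ℝ a).differentiableAt (x := x) v
    rw [gradient, InnerProductSpace.toDual_symm_apply]
    refine h1.trans ?_
    rw [ContinuousLinearMap.fderiv, innerSL_apply_apply]
    simp only [tangentProj_apply, inner_sub_left, inner_sub_right, real_inner_smul_left,
        real_inner_smul_right]
    rw [real_inner_comm (x : RSpace 4) a]
    ring
  rw [sphereGrad, h, tangentProj_eq_self (inner_tangentProj hr x a)]

theorem mapDeriv_sphereGrad_inner (x : RoundSphere 4 (√2)) (a : RSpace 4)
    {f : RoundSphere 4 (√2) → ℝ} (hf : ∀ y, f y = inner ℝ a (y : RSpace 4)) :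
    mapDeriv hopfMap x (sphereGrad f x) = hopfSection a x := by
  rw [sphereGrad_inner x a hf, mapDeriv_hopfMap,
    tangentProj_eq_self (inner_tangentProj sqrt_two_pos x a), tangentProj_apply,
    Real.sq_sqrt (by norm_num), hopfSection, map_sub, map_smul, smul_sub, smul_smul,
    real_inner_comm]
  congr 2
  ring

theorem tangentProj_hopfBilin_eq_hopfSection (x : RoundSphere 4 (√2)) (a : RSpace 4) :
    tangentProj (hopfMap x) (hopfBilin (x : RSpace 4) a) = (1 / 2 : ℝ) • hopfSection a x := by
  rw [tangentProj_hopfMap, inner_hopfBilin_self, norm_sq_eq_two, hopfSection, smul_sub, smul_smul,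
    smul_smul, real_inner_comm]
  norm_num
  congr 1
  ring

theorem inner_hopfMap_hopfSection (x : RoundSphere 4 (√2)) (a : RSpace 4) :
    inner ℝ (hopfMap x : RSpace 3) (hopfSection a x) = 0 := by
  have h : hopfSection a x
      = tangentProj (hopfMap x) ((2 : ℝ) • hopfBilin (x : RSpace 4) a) := by
    rw [map_smul, tangentProj_hopfBilin_eq_hopfSection, smul_smul]; norm_num
  rw [h, inner_tangentProj one_div_sqrt_two_pos]

theorem hasFDerivAt_hopfSection (a x : RSpace 4) :
    HasFDerivAt (hopfSection a) ((2 : ℝ) • hopfBilin.flip a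
      - ((innerSL ℝ a).smulRight (hopfBilin x x) + inner ℝ a x • ((2 : ℝ) • hopfBilin x))) x := by
  refine ((((hopfBilin.flip a).hasFDerivAt (x := x)).const_smul (2 : ℝ)).sub
    (((innerSL ℝ a).hasFDerivAt (x := x)).smul (hasFDerivAt_hopfBilin_self x))).congr_fderiv ?_
  ext1 v
  simp [add_comm]

theorem contDiff_hopfSection (a : RSpace 4) : ContDiff ℝ ∞ (hopfSection a) :=
  (((hopfBilin.flip a).contDiff).const_smul (2 : ℝ)).sub
    ((innerSL ℝ a).contDiff.smul contDiff_hopfBilin_self)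

theorem secondCovDeriv_hopfSection (x : RoundSphere 4 (√2)) (a : RSpace 4) {X Y : RSpace 4}
    (hX : inner ℝ (x : RSpace 4) X = 0) (hY : inner ℝ (x : RSpace 4) Y = 0) :
    secondCovDeriv hopfMap (fun y : RoundSphere 4 (√2) => hopfSection a y) x X Y
      = -(inner ℝ X Y / 2) • hopfSection a x - (2 * inner ℝ a Y) • hopfBilin (x : RSpace 4) X
        - (2 * inner ℝ a X) • hopfBilin (x : RSpace 4) Y
        - (2 * inner ℝ a (x : RSpace 4)) • tangentProj (hopfMap x) (hopfBilin X Y)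
        + (16 * inner ℝ (hopfBilin (x : RSpace 4) Y) (hopfBilin (x : RSpace 4) a)) •
          hopfBilin (x : RSpace 4) X := by
  have hr := sqrt_two_pos
  set Z : RSpace 4 → RSpace 4 := fun y => projExtend (√2) y Y with hZdef
  -- `w` is the ambient derivative of the section along the extended field, and `c y • B(y, y)` is
  -- its component normal to the target.
  set w : RSpace 4 → RSpace 3 := fun y => (2 : ℝ) • hopfBilin.flip a (Z y)
    - (innerSL ℝ a (Z y) • hopfBilin y y + innerSL ℝ a y • ((2 : ℝ) • hopfBilin y (Z y))) with hwdef
  set c : RSpace 4 → ℝ := fun y => 2 * inner ℝ (hopfBilin y y) (w y) with hcdef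
  have h1 : ∀ y : RoundSphere 4 (√2), pullbackConn hopfMap
      (fun y : RoundSphere 4 (√2) => hopfSection a y) y (extendField (√2) Y y)
      = (fun y : RSpace 4 => w y - c y • hopfBilin y y) (y : RSpace 4) := by
    intro y
    rw [pullbackConn, sphereDeriv_eq (G := hopfSection a) hr (fun _ => rfl)
      (hasFDerivAt_hopfSection a _).differentiableAt, (hasFDerivAt_hopfSection a _).fderiv,
      extendField, tangentProj_eq_self (inner_tangentProj hr y Y),
      tangentProj_eq_projExtend y Y, tangentProj_hopfMap]
    simp [hcdef, hwdef, hZdef, two_smul]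
  have hZ : HasFDerivAt Z (fderiv ℝ Z x) (x : RSpace 4) :=
    (hasFDerivAt_projExtend_const (√2) (x : RSpace 4) Y).differentiableAt.hasFDerivAt
  have hZX : fderiv ℝ Z x X = -(inner ℝ X Y / 2) • (x : RSpace 4) := fderiv_projExtend_apply x hY
  have hZx : Z x = Y := projExtend_sqrt_two_self x hY
  have hΦ := hasFDerivAt_hopfBilin_self (x : RSpace 4)
  have ha := (innerSL ℝ a).hasFDerivAt (x := (x : RSpace 4))
  have hw : HasFDerivAt w _ (x : RSpace 4) :=
    (((hopfBilin.flip a).hasFDerivAt.comp (x : RSpace 4) hZ).const_smul (2 : ℝ)).sub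
      ((((innerSL ℝ a).hasFDerivAt.comp (x : RSpace 4) hZ).smul hΦ).add
        (ha.smul ((hopfBilin.hasFDerivAt.clm_apply hZ).const_smul (2 : ℝ))))
  have hwX : fderiv ℝ w x X = -inner ℝ X Y • hopfBilin (x : RSpace 4) a
      - (2 * inner ℝ a Y) • hopfBilin (x : RSpace 4) X
      - (2 * inner ℝ a X) • hopfBilin (x : RSpace 4) Y
      - (2 * inner ℝ a (x : RSpace 4)) • hopfBilin X Y
      + (3 * (inner ℝ X Y / 2) * inner ℝ a (x : RSpace 4)) •
        hopfBilin (x : RSpace 4) (x : RSpace 4) := by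
    rw [hw.fderiv]
    simp [hZX, hZx, inner_smul_right]
    module
  have hc : HasFDerivAt c (fderiv ℝ c x) (x : RSpace 4) :=
    ((hΦ.inner ℝ hw).const_mul 2).differentiableAt.hasFDerivAt
  have hG : HasFDerivAt (fun y => w y - c y • hopfBilin y y) _ (x : RSpace 4) :=
    hw.differentiableAt.hasFDerivAt.sub (hc.smul hΦ)
  -- Only the value of `c` at `x` matters: its derivative multiplies `B(x, x)`, which the projection
  -- kills.
  have hcx : c x = -8 * inner ℝ (hopfBilin (x : RSpace 4) Y) (hopfBilin (x : RSpace 4) a) := by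
    have h2 := inner_hopfBilin_add (x : RSpace 4) Y a
    rw [hY, norm_sq_eq_two] at h2
    have h3 : inner ℝ (x : RSpace 4) (x : RSpace 4) = 2 := by
      rw [real_inner_self_eq_norm_sq, norm_sq_eq_two]
    simp only [hcdef, hwdef, hZx, inner_sub_right, inner_add_right, real_inner_smul_right, h3,
      inner_hopfBilin_self, hY, norm_sq_eq_two, ContinuousLinearMap.flip_apply,
      innerSL_apply_apply]
    linarith
  rw [secondCovDeriv, leviCivita_extendField_eq_zero hr x hX hY]
  have hGX : fderiv ℝ (fun y => w y - c y • hopfBilin y y) (x : RSpace 4) X = fderiv ℝ w x X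
      - (c x • (2 : ℝ) • hopfBilin (x : RSpace 4) X
        + fderiv ℝ c x X • hopfBilin (x : RSpace 4) (x : RSpace 4)) :=
    congrArg (fun L => L X) hG.fderiv
  rw [pullbackConn, sphereDeriv_eq hr h1 hG.differentiableAt, pullbackConn, map_zero, map_zero,
    sub_zero, tangentProj_eq_self hX, hGX]
  simp only [hwX, hcx, map_sub, map_add, map_smul, tangentProj_hopfMap_self, tangentProj_hopfBilin x hX,
    tangentProj_hopfBilin x hY]
  rw [tangentProj_hopfBilin_eq_hopfSection]
  module

/-- In the trace over `ℝ⁴` the multiples of `B(x, a)` cancel, as `-2 - 2 + 4`, and `-2 V` remains.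
Removing the radial direction adds `V / 2`. -/
theorem roughLaplacian_hopfSection (x : RoundSphere 4 (√2)) (a : RSpace 4) :
    roughLaplacian hopfMap (fun y : RoundSphere 4 (√2) => hopfSection a y) x
      = (3 / 2 : ℝ) • hopfSection a x := by
  rw [roughLaplacian, tangentTrace_eq x _ (LinearMap.mk₂ ℝ (fun X Y : RSpace 4 =>
        -(inner ℝ X Y / 2) • hopfSection a x - (2 * inner ℝ a Y) • hopfBilin (x : RSpace 4) X
        - (2 * inner ℝ a X) • hopfBilin (x : RSpace 4) Y
        - (2 * inner ℝ a (x : RSpace 4)) • tangentProj (hopfMap x) (hopfBilin X Y)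
        + (16 * inner ℝ (hopfBilin (x : RSpace 4) Y) (hopfBilin (x : RSpace 4) a)) •
          hopfBilin (x : RSpace 4) X)
      (by intros; simp only [inner_add_left, inner_add_right, map_add, add_apply]; module)
      (by intros; simp only [real_inner_smul_left, real_inner_smul_right, map_smul, smul_apply]
          module)
      (by intros; simp only [inner_add_left, inner_add_right, map_add]; module)
      (by intros; simp only [real_inner_smul_left, real_inner_smul_right, map_smul]; module))
    (fun X Y hX hY => secondCovDeriv_hopfSection x a hX hY)]
  have h1 : ∑ j : Fin 4, -(inner ℝ (stdVec j) (stdVec j) / 2 : ℝ) • hopfSection a x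
      = (-2 : ℝ) • hopfSection a x := by
    rw [← Finset.sum_smul]; congr 1; simp; norm_num
  have h2 : ∑ j, (2 * inner ℝ a (stdVec j) : ℝ) • hopfBilin (x : RSpace 4) (stdVec j)
      = (2 : ℝ) • hopfBilin (x : RSpace 4) a := by
    conv_rhs => rw [← sum_smul_stdVec a]
    simp [map_sum, Finset.smul_sum, smul_smul, EuclideanSpace.inner_single_right]
  have h3 : ∑ j, (2 * inner ℝ a (x : RSpace 4) : ℝ) •
      tangentProj (hopfMap x) (hopfBilin (stdVec j) (stdVec j)) = 0 := by
    rw [← Finset.smul_sum, ← map_sum, sum_hopfBilin_stdVec, map_zero, smul_zero]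
  have h4 : ∑ j, (16 * inner ℝ (hopfBilin (x : RSpace 4) (stdVec j))
      (hopfBilin (x : RSpace 4) a) : ℝ) • hopfBilin (x : RSpace 4) (stdVec j)
      = (4 : ℝ) • hopfBilin (x : RSpace 4) a := by
    simp_rw [mul_smul]
    rw [← Finset.smul_sum, sum_inner_smul_hopfBilin_stdVec, norm_sq_eq_two, smul_smul]
    norm_num
  simp only [LinearMap.mk₂_apply, Finset.sum_add_distrib, Finset.sum_sub_distrib, h1, h2, h3, h4]
  simp only [tangentProj_hopfMap_self, inner_hopfBilin_self, real_inner_self_eq_norm_sq, norm_sq_eq_two,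
    Real.sq_sqrt zero_le_two]
  rw [real_inner_comm (x : RSpace 4) a]
  module

/-- The target has curvature `2`, and the Hopf map is a Riemannian submersion onto a surface, so the
trace is `2 (V - 2 V)`. In coordinates, `ℝ⁴` contributes `2 V - 6 V` and removing the radial
direction adds `2 V`. -/
theorem trace_sphereCurvature_hopfSection (x : RoundSphere 4 (√2)) (a : RSpace 4) :
    tangentTrace x (fun X Y => sphereCurvature (hopfMap x) (mapDeriv hopfMap x X)
      (hopfSection a x) (mapDeriv hopfMap x Y)) = (-2 : ℝ) • hopfSection a x := by
  rw [tangentTrace_eq x _ (LinearMap.mk₂ ℝ (fun X Y : RSpace 4 =>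
        (8 * inner ℝ (hopfBilin (x : RSpace 4) Y) (hopfSection a x)) • hopfBilin (x : RSpace 4) X
        - (8 * inner ℝ (hopfBilin (x : RSpace 4) X) (hopfBilin (x : RSpace 4) Y)) •
          hopfSection a x)
      (by intros; simp only [inner_add_left, map_add]; module)
      (by intros; simp only [real_inner_smul_left, map_smul]; module)
      (by intros; simp only [inner_add_left, inner_add_right, map_add]; module)
      (by intros; simp only [real_inner_smul_left, real_inner_smul_right, map_smul]; module))
    (fun X Y hX hY => ?_)]
  · have h1 : ∑ j, (8 * inner ℝ (hopfBilin (x : RSpace 4) (stdVec j)) (hopfSection a x) : ℝ) •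
        hopfBilin (x : RSpace 4) (stdVec j) = (2 : ℝ) • hopfSection a x := by
      simp_rw [mul_smul]
      rw [← Finset.smul_sum, sum_inner_smul_hopfBilin_stdVec, norm_sq_eq_two, smul_smul]
      norm_num
    have h2 : ∑ j, (8 * inner ℝ (hopfBilin (x : RSpace 4) (stdVec j))
        (hopfBilin (x : RSpace 4) (stdVec j)) : ℝ) • hopfSection a x
        = (6 : ℝ) • hopfSection a x := by
      rw [← Finset.sum_smul, ← Finset.mul_sum, sum_inner_hopfBilin_stdVec, norm_sq_eq_two]
      norm_num
    have h3 := inner_hopfMap_hopfSection x a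
    rw [hopfMap_eq] at h3
    have h4 := inner_hopfBilin_self (x : RSpace 4) x
    rw [real_inner_self_eq_norm_sq (x : RSpace 4), norm_sq_eq_two] at h4
    simp only [LinearMap.mk₂_apply, Finset.sum_sub_distrib, h1, h2, h3, h4,
      Real.sq_sqrt zero_le_two]
    module
  · have hs := one_div_sqrt_two_pos
    have h5 := inner_hopfBilin_of_inner_eq_zero x hX
    have h6 := inner_hopfBilin_of_inner_eq_zero x hY
    have h7 := sphereCurvature_eq (X := (2 : ℝ) • hopfBilin (x : RSpace 4) X)
      (Z := (2 : ℝ) • hopfBilin (x : RSpace 4) Y) hs (hopfMap x)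
      (by rw [real_inner_smul_right, h5, mul_zero])
      (inner_hopfMap_hopfSection x a) (by rw [real_inner_smul_right, h6, mul_zero])
    simp only [mapDeriv_hopfMap, tangentProj_eq_self hX, tangentProj_eq_self hY]
    refine h7.trans ?_
    rw [LinearMap.mk₂_apply, div_pow, Real.sq_sqrt zero_le_two]
    simp only [real_inner_smul_left, real_inner_smul_right, real_inner_comm (hopfSection a x)]
    module

theorem jacobiOperator_hopfSection (x : RoundSphere 4 (√2)) (a : RSpace 4) :
    jacobiOperator hopfMap (fun y : RoundSphere 4 (√2) => hopfSection a y) x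
      = (-(1 / 2) : ℝ) • hopfSection a x := by
  rw [jacobiOperator, roughLaplacian_hopfSection, trace_sphereCurvature_hopfSection]
  module

theorem exists_eq_hopfSection {V : RoundSphere 4 (√2) → RSpace 3}
    (hV : V ∈ hopfGradSections (3 / 2)) :
    ∃ a : RSpace 4, V = fun y : RoundSphere 4 (√2) => hopfSection a y := by
  obtain ⟨f, hf, he, rfl⟩ := hV
  obtain ⟨a, ha⟩ := exists_eq_inner_of_sphereLaplacian_eq sqrt_two_pos (by norm_num) hf
    (fun x => by rw [he, Real.sq_sqrt zero_le_two]; norm_num)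
  exact ⟨a, funext fun x => mapDeriv_sphereGrad_inner x a ha⟩

end Hopf

theorem theorem4p5 :
    IsHarmonicSphereMap hopfMap ∧
    IsLeast {μ : ℝ | 0 < μ ∧ IsSphereEigenvalue 4 (√2) μ} (3 / 2) ∧
    hopfGradSections (3 / 2) ⊆ pullbackSections hopfMap ∧
    JacobiNegDefOn (Real.sqrt_nonneg 2) hopfMap (hopfGradSections (3 / 2)) := by
  refine ⟨isHarmonicSphereMap_hopfMap, ?_, fun V hV => ?_, fun V hV hne => ?_⟩
  · have h := isLeast_sphereEigenvalue (n := 4) sqrt_two_pos (by norm_num)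
    rw [Real.sq_sqrt zero_le_two] at h
    norm_num at h
    exact h
  · obtain ⟨a, rfl⟩ := exists_eq_hopfSection hV
    exact ⟨sphereSmooth_of_contDiffOn sqrt_two_pos (fun _ => rfl)
      (contDiff_hopfSection a).contDiffOn,
      fun x => (mem_tangentAt _ _).2 (inner_hopfMap_hopfSection x a)⟩
  · obtain ⟨a, rfl⟩ := exists_eq_hopfSection hV
    have := isOpenPosMeasure_sphereVolume (n := 4) sqrt_two_pos
    obtain ⟨x₀, hx₀⟩ := Function.ne_iff.1 hne
    have hcont : Continuous fun x : RoundSphere 4 (√2) => hopfSection a x :=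
      (contDiff_hopfSection a).continuous.comp continuous_subtype_val
    -- A continuous section that is nonzero at `x₀` has positive `L²` norm, because the volume
    -- charges every nonempty open set.
    have hpos := (hcont.norm.pow 2).integral_pos_of_hasCompactSupport_nonneg_nonzero
      (μ := sphereVolume 4 (Real.sqrt_nonneg 2)) (x := x₀)
      (HasCompactSupport.of_compactSpace _) (fun x => sq_nonneg _)
      (pow_ne_zero 2 (norm_ne_zero_iff.2 hx₀))
    simp_rw [jacobiOperator_hopfSection, real_inner_smul_left, real_inner_self_eq_norm_sq]
    rw [integral_const_mul]
    simp only [Pi.pow_apply] at hpos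
    linarith
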